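/- Let $q=2^k$ with $k\ge 1$, and let $V$ be a four-dimensional vector space over $\mathrm{GF}(q^2)$ with a non-degenerate Hermitian form $h$. Let $\mathrm{H}(3,q^2)$ be the set of totally isotropic points and lines of $h$ in $\mathrm{PG}(V)=\mathrm{PG}(3,q^2)$, and let $\mathrm{P\Gamma U}(4,q)$ be its collineation group, i.e. the group of all collineations of $\mathrm{PG}(V)$ induced by invertible semilinear maps of $V$ that stabilise the set of points of $\mathrm{H}(3,q^2)$. Let $\mathrm{W}(3,q)$ be embedded in $\mathrm{H}(3,q^2)$ as the restriction of $h$ to a four-dimensional $\mathrm{GF}(q)$-subspace $W$ of $V$ that spans $V$ over $\mathrm{GF}(q^2)$ and on which $h$ is an alternating $\mathrm{GF}(q)$-valued form. The set $\mathcal L_E$ of external lines consists of the lines of $\mathrm{H}(3,q^2)$ that contain no point of $\mathrm{W}(3,q)$. Let $\mathcal Q^+$ be a hyperbolic quadric of $\mathrm{PG}(3,q^2)$ (a non-singular quadric containing lines) whose set of common points with $\mathrm{H}(3,q^2)$ is an elliptic quadric $\mathrm{Q}^-(3,q)$ (a non-singular quadric containing no lines) of the subgeometry $\mathrm{PG}(W)\cong\mathrm{PG}(3,q)$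 underlying $\mathrm{W}(3,q)$. Let $\mathrm{P\Gamma U}(4,q)_{\mathcal Q^+}$ be the stabiliser of $\mathcal Q^+$ in $\mathrm{P\Gamma U}(4,q)$, let $D$ be the subgroup of $\mathrm{P\Gamma U}(4,q)_{\mathcal Q^+}$ that fixes each of the two reguli (families of mutually skew lines) of $\mathcal Q^+$, and let $G$ be a subgroup of $\mathrm{P\Gamma U}(4,q)_{\mathcal Q^+}$. If $G$ is not contained in $D$, then $G$ acts on the set $\mathcal L_E/(G\cap D)$ of orbits of $G\cap D$ on $\mathcal L_E$, and it acts semiregularly on it in the following sense: every element of $G$ that fixes some element of $\mathcal L_E/(G\cap D)$ fixes every element of $\mathcal L_E/(G\cap D)$. -/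

import Mathlib

open Module
open scoped Pointwise

namespace HermitianQuadric

/-! ### Quadrics -/

section Quadric

variable {F V : Type*} [Field F] [AddCommGroup V] [Module F V]

/-- The points of the quadric of `Q`: the one-dimensional totally singular subspaces. -/
def quadricPoints (Q : QuadraticForm F V) : Set (Submodule F V) :=
  {P | finrank F P = 1 ∧ ∀ x ∈ P, Q x = 0}

/-- The lines of the quadric of `Q`: the two-dimensional totally singular subspaces. -/
def quadricLines (Q : QuadraticForm F V) : Set (Submodule F V) :=
  {L | finrank F L = 2 ∧ ∀ x ∈ L, Q x = 0}

/-- A quadratic form is non-singular if no nonzero singular vector lies in the radical of the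
polar form. -/
def IsNonsingular (Q : QuadraticForm F V) : Prop :=
  ∀ x, Q x = 0 → (∀ y, QuadraticMap.polar Q x y = 0) → x = 0

/-- In a projective 3-space, a hyperbolic quadric is a non-singular quadric containing lines. -/
def IsHyperbolic (Q : QuadraticForm F V) : Prop :=
  finrank F V = 4 ∧ IsNonsingular Q ∧ (quadricLines Q).Nonempty

/-- In a projective 3-space (over a finite field), an elliptic quadric is a non-singular quadric
containing no lines. -/
def IsElliptic (Q : QuadraticForm F V) : Prop :=
  finrank F V = 4 ∧ IsNonsingular Q ∧ quadricLines Q = ∅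

/-- The regulus (family of mutually skew lines) of a hyperbolic quadric containing the line `L`:
`L` together with all lines of the quadric that are skew to `L`. -/
def regulusOf (Q : QuadraticForm F V) (L : Submodule F V) : Set (Submodule F V) :=
  {M | M ∈ quadricLines Q ∧ (M = L ∨ Disjoint M L)}

/-- The reguli of a hyperbolic quadric (there are two of them). -/
def reguli (Q : QuadraticForm F V) : Set (Set (Submodule F V)) :=
  {R | ∃ L ∈ quadricLines Q, R = regulusOf Q L}

end Quadric

/-! ### Groups of collineations -/

section Collineations

variable (F V : Type*) [Field F] [AddCommGroup V] [Module F V]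

/-- `PΓL(V)`: the group of those automorphisms of the lattice of subspaces of `V` (the projective
space of `V`) that are induced by invertible semilinear maps `T`, for any automorphism `σ`
of the field. -/
def PGammaL : Subgroup (Submodule F V ≃o Submodule F V) where
  carrier := {g | ∃ (σ : F ≃+* F) (T : V ≃+ V), (∀ (a : F) (x : V), T (a • x) = σ a • T x) ∧
    ∀ (S : Submodule F V) (x : V), T x ∈ g S ↔ x ∈ S}
  mul_mem' := by
    rintro g g' ⟨σ, T, hT, hg⟩ ⟨σ', T', hT', hg'⟩
    refine ⟨σ'.trans σ, T'.trans T, fun a x => ?_, fun S x => ?_⟩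
    · simp [hT, hT']
    · exact (hg (g' S) (T' x)).trans (hg' S x)
  one_mem' := ⟨RingEquiv.refl F, AddEquiv.refl V, fun _ _ => rfl, fun _ _ => Iff.rfl⟩
  inv_mem' := by
    rintro g ⟨σ, T, hT, hg⟩
    refine ⟨σ.symm, T.symm, fun a x => ?_, fun S x => ?_⟩
    · apply T.injective
      simp [hT]
    · have h := hg (g⁻¹ S) (T.symm x)
      have e : g (g⁻¹ S) = S := g.apply_symm_apply S
      rw [e, T.apply_symm_apply] at h
      exact h.symm

end Collineations

section Semiregular

variable {A X : Type*} [Group A] [MulAction A X]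

/-- `G` acts on `Ω`, and semiregularly so: an element of `G` that fixes an element of `Ω` is in
the kernel of the action on `Ω`. -/
def ActsSemiregularlyOn (G : Subgroup A) (Ω : Set X) : Prop :=
  (∀ g ∈ G, ∀ ω ∈ Ω, g • ω ∈ Ω) ∧
    ∀ g ∈ G, ∀ ω ∈ Ω, g • ω = ω → ∀ ω' ∈ Ω, g • ω' = ω'

/-- The set of orbits of `N` on (the elements of) `Ω`. -/
def orbitsOn (N : Subgroup A) (Ω : Set X) : Set (Set X) :=
  {O | ∃ ω ∈ Ω, O = MulAction.orbit N ω}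

end Semiregular

/-! ### The Hermitian surface `H(3,q²)` and the symplectic space `W(3,q)`, where `q = 2 ^ k` -/

/-- The subfield `{a | a ^ q = a}` of `F`, `q = 2 ^ k`; it is `GF(q)` if `F = GF(q²)`. -/
def subfieldGF (F : Type*) [Field F] [CharP F 2] (k : ℕ) : Subfield F :=
  (iterateFrobenius F 2 k).eqLocusField (RingHom.id F)

section Hermitian

variable {F V : Type*} [Field F] [CharP F 2] [AddCommGroup V] [Module F V] {k : ℕ}

/-- `h`, linear in the first variable and semilinear for `a ↦ a ^ q` in the second one, is a
non-degenerate Hermitian form. -/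
def IsHermitianForm (h : V →ₗ[F] V →ₛₗ[iterateFrobenius F 2 k] F) : Prop :=
  (∀ x y, h y x = h x y ^ 2 ^ k) ∧ ∀ x, (∀ y, h x y = 0) → x = 0

/-- The totally isotropic points. -/
def hermitianPoints (h : V →ₗ[F] V →ₛₗ[iterateFrobenius F 2 k] F) : Set (Submodule F V) :=
  {P | finrank F P = 1 ∧ ∀ x ∈ P, ∀ y ∈ P, h x y = 0}

/-- The totally isotropic lines. -/
def hermitianLines (h : V →ₗ[F] V →ₛₗ[iterateFrobenius F 2 k] F) : Set (Submodule F V) :=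
  {L | finrank F L = 2 ∧ ∀ x ∈ L, ∀ y ∈ L, h x y = 0}

/-- `W` is a `GF(q)`-form of the four-dimensional space `V` (so it gives a subgeometry `PG(3,q)`),
and `h` restricts to an alternating `GF(q)`-valued form on `W` (automatically non-degenerate if
`h` is). This is the embedding of `W(3,q)` in `H(3,q²)`. -/
def IsSymplecticSubgeometry (h : V →ₗ[F] V →ₛₗ[iterateFrobenius F 2 k] F)
    (W : Submodule (subfieldGF F k) V) : Prop :=
  finrank (subfieldGF F k) W = 4 ∧ Submodule.span F (W : Set V) = ⊤ ∧
    (∀ x ∈ W, ∀ y ∈ W, h x y ∈ subfieldGF F k) ∧ ∀ x ∈ W, h x x = 0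

/-- The external lines: the lines of `H(3,q²)` that contain no point of `W(3,q)`. -/
def externalLines (h : V →ₗ[F] V →ₛₗ[iterateFrobenius F 2 k] F)
    (W : Submodule (subfieldGF F k) V) : Set (Submodule F V) :=
  {L | L ∈ hermitianLines h ∧ ∀ x ∈ W, x ∈ L → x = 0}

/-- The points of `PG(V)` given by the singular points of a quadric of the subgeometry `W`. -/
def subgeometryQuadricPoints (W : Submodule (subfieldGF F k) V)
    (Q₀ : QuadraticForm (subfieldGF F k) W) : Set (Submodule F V) :=
  {P | ∃ x : W, x ≠ 0 ∧ Q₀ x = 0 ∧ P = Submodule.span F {(x : V)}}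

/-- `PΓU(4,q)`: the collineation group of `H(3,q²)`. -/
def PGammaU (h : V →ₗ[F] V →ₛₗ[iterateFrobenius F 2 k] F) :
    Subgroup (Submodule F V ≃o Submodule F V) :=
  PGammaL F V ⊓ MulAction.stabilizer (Submodule F V ≃o Submodule F V) (hermitianPoints h)

/-- The stabiliser in `PΓU(4,q)` of the quadric of `Q`. -/
def quadricStabilizer (h : V →ₗ[F] V →ₛₗ[iterateFrobenius F 2 k] F) (Q : QuadraticForm F V) :
    Subgroup (Submodule F V ≃o Submodule F V) :=
  PGammaU h ⊓ MulAction.stabilizer (Submodule F V ≃o Submodule F V) (quadricPoints Q)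

/-- The subgroup of the stabiliser of the quadric fixing each of the two families of lines. -/
def regulusStabilizer (h : V →ₗ[F] V →ₛₗ[iterateFrobenius F 2 k] F) (Q : QuadraticForm F V) :
    Subgroup (Submodule F V ≃o Submodule F V) :=
  quadricStabilizer h Q ⊓
    ⨅ R ∈ reguli Q, MulAction.stabilizer (Submodule F V ≃o Submodule F V) R

end Hermitian

end HermitianQuadric

namespace HermitianQuadric

/-! ### Expansion of quadratic forms and dimension counts over any field -/

section Quadric

variable {F V : Type*} [Field F] [AddCommGroup V] [Module F V]

/-! The heart of the matter is that an element `g` of the stabiliser of the quadric that fixes an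
external line `L` lies in `D` (`mem_regulusStabilizer_of_smul_eq`). The rest is formal, since `G`
normalises `D`: if `g` fixes the orbit of `ω`, then `n⁻¹ * g` fixes `ω` for some `n` in `G ⊓ D`, so
`g` lies in `G ⊓ D` and fixes every orbit.

On the elliptic quadric the polarities of `Q` and `h` agree. Hence, after rescaling `Q`, one has `h
x y = polar Q x (τ y)` with `τ` the Baer involution fixing `W` (`exists_isBaerInvolution`), and
every `g` is induced by a semilinear similitude `T` of `Q` commuting with `τ`
(`exists_commuting_semisimilitude`).

That `L` is totally isotropic means that `L` and `τ L` are orthogonal for `Q`. That `L` is external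
makes `Q` anisotropic on `L`, because a singular vector of `L` is also isotropic and so a multiple
of a vector of `W`. Thus `V` is the direct sum of `L` and `τ L`, and each line `M` of the quadric is
a graph `{x + τ (s x)}` with `s` a semilinear similitude of `L`. If `g` fixes `L`, then `T`
restricts to a map `t` of `L` and `g • M` is the graph of `t s t⁻¹`; if `g • M` meets `M`, then `t
s` and `s t` agree at a nonzero vector.

The anisotropic plane `L` is a one-dimensional space over a quadratic extension field `K` of `F`.
Both `s` and `t` act on the cyclic group `Kˣ` by conjugation, hence by power maps, and power maps
commute. So agreement at one nonzero vector propagates to all of `L` (`semisimilitude_comm`), and `g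
• M = M`. Therefore `g` maps every line of the quadric to itself or to a skew line
(`smul_eq_or_disjoint`), that is, within its regulus. -/

theorem finrank_span_singleton_le_one (r : V) : finrank F (Submodule.span F {r}) ≤ 1 := by
  simpa using finrank_span_le_card (R := F) ({r} : Set V)

theorem map_add_eq (Q : QuadraticForm F V) (x y : V) :
    Q (x + y) = Q x + Q y + QuadraticMap.polar Q x y := by
  rw [QuadraticMap.polar]; ring

theorem map_smul_eq (Q : QuadraticForm F V) (a : F) (x : V) : Q (a • x) = a ^ 2 * Q x := by
  rw [QuadraticMap.map_smul, smul_eq_mul, sq]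

/-- Given two vectors, there is a vector orthogonal to both outside any given line. -/
theorem exists_perp_notMem [FiniteDimensional F V] (Q : QuadraticForm F V) (x y r : V)
    (hV : finrank F V = 4) :
    ∃ z, QuadraticMap.polar Q x z = 0 ∧ QuadraticMap.polar Q y z = 0 ∧
      z ∉ Submodule.span F {r} := by
  set φ := (QuadraticMap.polarBilin Q x).prod (QuadraticMap.polarBilin Q y) with hφ
  have h1 := φ.finrank_range_add_finrank_ker
  have h2 : finrank F (LinearMap.range φ) ≤ 2 := by
    simpa using Submodule.finrank_le (LinearMap.range φ)
  have h3 : ¬ LinearMap.ker φ ≤ Submodule.span F {r} := by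
    intro h
    have := Submodule.finrank_mono h
    have := finrank_span_singleton_le_one (F := F) r
    omega
  obtain ⟨z, hz, hzr⟩ := SetLike.not_le_iff_exists.1 h3
  rw [LinearMap.mem_ker, hφ] at hz
  simp only [LinearMap.prod_apply, Function.prod_apply, Prod.mk_eq_zero] at hz
  exact ⟨z, by simpa using hz.1, by simpa using hz.2, hzr⟩

theorem exists_polar_eq_one (Q : QuadraticForm F V) {x : V}
    (hx : ¬ ∀ y, QuadraticMap.polar Q x y = 0) : ∃ y, QuadraticMap.polar Q x y = 1 := by
  push Not at hx
  obtain ⟨y, hy⟩ := hx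
  exact ⟨(QuadraticMap.polar Q x y)⁻¹ • y, by
    rw [QuadraticMap.polar_smul_right, smul_eq_mul, inv_mul_cancel₀ hy]⟩

theorem map_basis_four (Q : QuadraticForm F V) (b : Basis (Fin 4) F V) (x₀ x₁ x₂ x₃ : F) :
    Q (x₀ • b 0 + x₁ • b 1 + x₂ • b 2 + x₃ • b 3) =
      x₀ ^ 2 * Q (b 0) + x₁ ^ 2 * Q (b 1) + x₂ ^ 2 * Q (b 2) + x₃ ^ 2 * Q (b 3) +
      x₀ * x₁ * QuadraticMap.polar Q (b 0) (b 1) + x₀ * x₂ * QuadraticMap.polar Q (b 0) (b 2) +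
      x₀ * x₃ * QuadraticMap.polar Q (b 0) (b 3) + x₁ * x₂ * QuadraticMap.polar Q (b 1) (b 2) +
      x₁ * x₃ * QuadraticMap.polar Q (b 1) (b 3) + x₂ * x₃ * QuadraticMap.polar Q (b 2) (b 3) := by
  simp only [map_add_eq, map_smul_eq, QuadraticMap.polar_add_left, QuadraticMap.polar_smul_left,
    QuadraticMap.polar_smul_right, smul_eq_mul]
  ring

end Quadric

/-! ### Normal forms of quadrics of a 3-space in characteristic 2 -/

section CharTwoQuadric

variable {F V : Type*} [Field F] [CharP F 2] [AddCommGroup V] [Module F V]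

theorem exists_sq_eq [Finite F] (a : F) : ∃ c : F, c ^ 2 = a := by
  obtain ⟨c, hc⟩ := FiniteField.isSquare_of_char_two (ringChar.eq F 2) a
  exact ⟨c, by rw [hc, sq]⟩

theorem polar_self_eq_zero (Q : QuadraticForm F V) (x : V) : QuadraticMap.polar Q x x = 0 := by
  rw [QuadraticMap.polar_self, two_nsmul, CharTwo.add_self_eq_zero]

/-- Two orthogonal vectors span a subspace with a singular vector. -/
theorem exists_singular_comb [Finite F] (Q : QuadraticForm F V) (x y : V)
    (hxy : QuadraticMap.polar Q x y = 0) : ∃ a b : F, (a ≠ 0 ∨ b ≠ 0) ∧ Q (a • x + b • y) = 0 := by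
  by_cases hx : Q x = 0
  · exact ⟨1, 0, by simp, by simp [hx]⟩
  · obtain ⟨c, hc⟩ := exists_sq_eq (Q y / Q x)
    refine ⟨c, 1, by simp, ?_⟩
    rw [map_add_eq, map_smul_eq, map_smul_eq, QuadraticMap.polar_smul_left,
      QuadraticMap.polar_smul_right, hxy, hc, div_mul_cancel₀ _ hx]
    simp [CharTwo.add_self_eq_zero]

/-- Four vectors with the Gram matrix of two orthogonal symplectic pairs form a basis. -/
theorem exists_basis_of_polar (Q : QuadraticForm F V) (hV : finrank F V = 4) {e f z w : V}
    (hef : QuadraticMap.polar Q e f = 1) (hzw : QuadraticMap.polar Q z w = 1)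
    (hez : QuadraticMap.polar Q e z = 0) (hew : QuadraticMap.polar Q e w = 0)
    (hfz : QuadraticMap.polar Q f z = 0) (hfw : QuadraticMap.polar Q f w = 0) :
    ∃ b : Basis (Fin 4) F V, b 0 = e ∧ b 1 = f ∧ b 2 = z ∧ b 3 = w := by
  have hli : LinearIndependent F ![e, f, z, w] := by
    rw [Fintype.linearIndependent_iff]
    intro g hg
    simp only [Fin.sum_univ_four] at hg
    have key : ∀ y, g 0 * QuadraticMap.polar Q e y + g 1 * QuadraticMap.polar Q f y +
        g 2 * QuadraticMap.polar Q z y + g 3 * QuadraticMap.polar Q w y = 0 := by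
      intro y
      have := congrArg (fun v => QuadraticMap.polar Q v y) hg
      simpa [QuadraticMap.polar_add_left, QuadraticMap.polar_smul_left] using this
    have h0 := key f
    have h1 := key e
    have h2 := key w
    have h3 := key z
    simp only [QuadraticMap.polar_comm Q f e, QuadraticMap.polar_comm Q z e,
      QuadraticMap.polar_comm Q z f, QuadraticMap.polar_comm Q w e,
      QuadraticMap.polar_comm Q w f, QuadraticMap.polar_comm Q w z, hef, hzw, hez, hew, hfz, hfw,
      polar_self_eq_zero, mul_zero, mul_one, add_zero, zero_add] at h0 h1 h2 h3
    intro i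
    fin_cases i
    exacts [h0, h1, h2, h3]
  refine ⟨basisOfLinearIndependentOfCardEqFinrank hli (by simp [hV]), ?_, ?_, ?_, ?_⟩ <;> simp

/-- Adding a combination of `e` and `f` makes `w` orthogonal to `e` and `f`. -/
theorem exists_symplectic_partner (Q : QuadraticForm F V) {e f z w : V}
    (hef : QuadraticMap.polar Q e f = 1) (hez : QuadraticMap.polar Q e z = 0)
    (hfz : QuadraticMap.polar Q f z = 0) (hzw : QuadraticMap.polar Q z w = 1) :
    ∃ w', QuadraticMap.polar Q z w' = 1 ∧ QuadraticMap.polar Q e w' = 0 ∧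
      QuadraticMap.polar Q f w' = 0 := by
  refine ⟨w + (QuadraticMap.polar Q f w • e + QuadraticMap.polar Q e w • f), ?_, ?_, ?_⟩ <;>
  simp [QuadraticMap.polar_add_right, QuadraticMap.polar_smul_right,
    QuadraticMap.polar_comm Q f e, QuadraticMap.polar_comm Q z e,
    QuadraticMap.polar_comm Q z f, hef, hez, hfz, hzw,
    CharTwo.two_eq_zero, CharTwo.add_self_eq_zero]

/-- The polar form of a non-singular quadric of a projective 3-space is non-degenerate. -/
theorem IsNonsingular.polar_nondegenerate [Finite F] {Q : QuadraticForm F V}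
    (hQ : IsNonsingular Q) (hV : finrank F V = 4) {r : V}
    (hr : ∀ y, QuadraticMap.polar Q r y = 0) : r = 0 := by
  have : FiniteDimensional F V := FiniteDimensional.of_finrank_pos (by omega)
  by_contra hr0
  -- The radical is at most a line: two radical vectors are orthogonal, so some combination of them
  -- is singular and radical, hence zero.
  have hrad : ∀ x, (∀ y, QuadraticMap.polar Q x y = 0) → x ∈ Submodule.span F {r} := by
    intro x hx
    obtain ⟨a, b, hab, h0⟩ := exists_singular_comb Q x r (hx r)
    have h1 := hQ _ h0 fun y => by
      simp [QuadraticMap.polar_add_left, QuadraticMap.polar_smul_left, hx, hr]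
    have ha : a ≠ 0 := by
      rintro rfl
      have hb : b ≠ 0 := by simpa using hab
      rw [zero_smul, zero_add] at h1
      exact (smul_ne_zero hb hr0) h1
    rw [Submodule.mem_span_singleton]
    refine ⟨-(a⁻¹ * b), ?_⟩
    have h2 : x = a⁻¹ • (a • x) := by rw [inv_smul_smul₀ ha]
    rw [h2, eq_neg_of_add_eq_zero_left h1, smul_neg, smul_smul, neg_smul]
  -- An alternating form has even rank: outside the radical line there is room for two orthogonal
  -- symplectic pairs, which already fill `V` and leave no radical.
  obtain ⟨e, -, -, he⟩ := exists_perp_notMem Q 0 0 r hV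
  obtain ⟨f, hef⟩ := exists_polar_eq_one Q fun h => he (hrad e h)
  obtain ⟨z, hez, hfz, hz⟩ := exists_perp_notMem Q e f r hV
  obtain ⟨w, hzw⟩ := exists_polar_eq_one Q fun h => hz (hrad z h)
  obtain ⟨w, hzw, hew, hfw⟩ := exists_symplectic_partner Q hef hez hfz hzw
  obtain ⟨b, rfl, rfl, rfl, rfl⟩ := exists_basis_of_polar Q hV hef hzw hez hew hfz hfw
  have hc := b.sum_repr r
  rw [Fin.sum_univ_four] at hc
  have key : ∀ y, QuadraticMap.polar Q (b.repr r 0 • b 0 + b.repr r 1 • b 1 + b.repr r 2 • b 2 +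
      b.repr r 3 • b 3) y = 0 := by
    rw [hc]; exact hr
  have h0 := key (b 1)
  have h1 := key (b 0)
  have h2 := key (b 3)
  have h3 := key (b 2)
  simp only [QuadraticMap.polar_add_left, QuadraticMap.polar_smul_left,
    QuadraticMap.polar_comm Q (b 1) (b 0), QuadraticMap.polar_comm Q (b 2) (b 0),
    QuadraticMap.polar_comm Q (b 2) (b 1), QuadraticMap.polar_comm Q (b 3) (b 0),
    QuadraticMap.polar_comm Q (b 3) (b 1), QuadraticMap.polar_comm Q (b 3) (b 2), hef, hzw, hez,
    hew, hfz, hfw, polar_self_eq_zero, smul_eq_mul, mul_zero, mul_one, add_zero, zero_add]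
    at h0 h1 h2 h3
  rw [h0, h1, h2, h3] at hc
  exact hr0 (by simpa using hc.symm)

/-- A basis consisting of two orthogonal symplectic pairs, the first one singular. -/
structure IsAdapted (Q : QuadraticForm F V) (b : Basis (Fin 4) F V) : Prop where
  map_zero : Q (b 0) = 0
  map_one : Q (b 1) = 0
  polar01 : QuadraticMap.polar Q (b 0) (b 1) = 1
  polar23 : QuadraticMap.polar Q (b 2) (b 3) = 1
  polar02 : QuadraticMap.polar Q (b 0) (b 2) = 0
  polar03 : QuadraticMap.polar Q (b 0) (b 3) = 0
  polar12 : QuadraticMap.polar Q (b 1) (b 2) = 0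
  polar13 : QuadraticMap.polar Q (b 1) (b 3) = 0

/-- A singular vector and a vector orthogonal to it extend to an adapted basis. -/
theorem IsNonsingular.exists_isAdapted [Finite F] {Q : QuadraticForm F V}
    (hQ : IsNonsingular Q) (hV : finrank F V = 4) {e z : V} (he : Q e = 0) (he0 : e ≠ 0)
    (hz : z ∉ Submodule.span F {e}) (hez : QuadraticMap.polar Q e z = 0) :
    ∃ b : Basis (Fin 4) F V, IsAdapted Q b ∧ b 0 = e ∧ b 2 = z ∧ (Q z = 0 → Q (b 3) = 0) := by
  have hz0 : z ≠ 0 := fun h => hz (h ▸ Submodule.zero_mem _)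
  obtain ⟨f₀, hzf₀⟩ := exists_polar_eq_one Q fun h => hz0 (hQ.polar_nondegenerate hV h)
  obtain ⟨f₁, hf₁, hef₁⟩ : ∃ f, QuadraticMap.polar Q z f = 0 ∧ QuadraticMap.polar Q e f ≠ 0 := by
    -- Otherwise the functional of `e` vanishes on the kernel of that of `z`, so it is a multiple of
    -- it, and nondegeneracy puts `z` on the line of `e`.
    by_contra! hcon
    set c := QuadraticMap.polar Q e f₀ with hc
    have h1 : e - c • z = 0 := by
      refine hQ.polar_nondegenerate hV fun y => ?_
      have := hcon (y - QuadraticMap.polar Q z y • f₀) (by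
        rw [QuadraticMap.polar_sub_right, QuadraticMap.polar_smul_right, hzf₀]; simp)
      rw [QuadraticMap.polar_sub_right, QuadraticMap.polar_smul_right, ← hc] at this
      rw [QuadraticMap.polar_sub_left, QuadraticMap.polar_smul_left, smul_eq_mul, mul_comm]
      exact this
    have h2 : e = c • z := sub_eq_zero.1 h1
    have hc0 : c ≠ 0 := by rintro h; rw [h, zero_smul] at h2; exact he0 h2
    exact hz (Submodule.mem_span_singleton.2 ⟨c⁻¹, by rw [h2, inv_smul_smul₀ hc0]⟩)
  obtain ⟨f₂, hf₂⟩ : ∃ f₂, f₂ = (QuadraticMap.polar Q e f₁)⁻¹ • f₁ := ⟨_, rfl⟩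
  have hef₂ : QuadraticMap.polar Q e f₂ = 1 := by
    rw [hf₂, QuadraticMap.polar_smul_right, smul_eq_mul, inv_mul_cancel₀ hef₁]
  have hzf₂ : QuadraticMap.polar Q z f₂ = 0 := by
    rw [hf₂, QuadraticMap.polar_smul_right, hf₁, smul_zero]
  -- As `e` is singular and paired to 1 with `f₂`, this correction adds `Q f₂` to `Q f₂`, which
  -- gives 0. The same device makes `w` singular below when `z` is singular.
  obtain ⟨f, hf⟩ : ∃ f, f = f₂ + Q f₂ • e := ⟨_, rfl⟩
  have hef : QuadraticMap.polar Q e f = 1 := by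
    rw [hf, QuadraticMap.polar_add_right, QuadraticMap.polar_smul_right, polar_self_eq_zero, hef₂]
    simp
  have hfz : QuadraticMap.polar Q f z = 0 := by
    rw [hf, QuadraticMap.polar_add_left, QuadraticMap.polar_smul_left, hez,
      QuadraticMap.polar_comm, hzf₂]
    simp
  have hff : Q f = 0 := by
    rw [hf, map_add_eq, map_smul_eq, he, QuadraticMap.polar_smul_right,
      QuadraticMap.polar_comm Q f₂ e, hef₂]
    simp [CharTwo.add_self_eq_zero]
  obtain ⟨w, hzw, hew, hfw⟩ := exists_symplectic_partner Q hef hez hfz hzf₀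
  by_cases hQz : Q z = 0
  · have hzw' : QuadraticMap.polar Q z (w + Q w • z) = 1 := by
      rw [QuadraticMap.polar_add_right, QuadraticMap.polar_smul_right, polar_self_eq_zero, hzw]
      simp
    have hew' : QuadraticMap.polar Q e (w + Q w • z) = 0 := by
      rw [QuadraticMap.polar_add_right, QuadraticMap.polar_smul_right, hez, hew]
      simp
    have hfw' : QuadraticMap.polar Q f (w + Q w • z) = 0 := by
      rw [QuadraticMap.polar_add_right, QuadraticMap.polar_smul_right, hfz, hfw]
      simp
    have hw' : Q (w + Q w • z) = 0 := by
      rw [map_add_eq, map_smul_eq, hQz, QuadraticMap.polar_smul_right,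
        QuadraticMap.polar_comm Q w z, hzw]
      simp [CharTwo.add_self_eq_zero]
    obtain ⟨b, h0, h1, h2, h3⟩ := exists_basis_of_polar Q hV hef hzw' hez hew' hfz hfw'
    exact ⟨b, ⟨by rwa [h0], by rwa [h1], by rwa [h0, h1], by rwa [h2, h3], by rwa [h0, h2],
      by rwa [h0, h3], by rwa [h1, h2], by rwa [h1, h3]⟩, h0, h2, fun _ => by rwa [h3]⟩
  · obtain ⟨b, h0, h1, h2, h3⟩ := exists_basis_of_polar Q hV hef hzw hez hew hfz hfw
    exact ⟨b, ⟨by rwa [h0], by rwa [h1], by rwa [h0, h1], by rwa [h2, h3], by rwa [h0, h2],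
      by rwa [h0, h3], by rwa [h1, h2], by rwa [h1, h3]⟩, h0, h2, fun h => absurd h hQz⟩

/-- Elements of a finite field of characteristic 2 are squares, so two independent orthogonal
vectors already combine to a nonzero singular one, from which an adapted basis can start. -/
theorem IsNonsingular.exists_adapted_basis [Finite F] {Q : QuadraticForm F V}
    (hQ : IsNonsingular Q) (hV : finrank F V = 4) : ∃ b : Basis (Fin 4) F V, IsAdapted Q b := by
  have : FiniteDimensional F V := FiniteDimensional.of_finrank_pos (by omega)
  obtain ⟨x, -, -, hx⟩ := exists_perp_notMem Q 0 0 0 hV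
  have hx0 : x ≠ 0 := by rintro rfl; exact hx (Submodule.zero_mem _)
  obtain ⟨y, hxy, -, hy⟩ := exists_perp_notMem Q x x x hV
  obtain ⟨a, b, hab, h0⟩ := exists_singular_comb Q x y hxy
  have he0 : a • x + b • y ≠ 0 := by
    intro h
    by_cases hb : b = 0
    · subst hb
      have ha : a ≠ 0 := by simpa using hab
      rw [zero_smul, add_zero] at h
      exact smul_ne_zero ha hx0 h
    · refine hy (Submodule.mem_span_singleton.2 ⟨-(b⁻¹ * a), ?_⟩)
      have h2 : y = b⁻¹ • (b • y) := by rw [inv_smul_smul₀ hb]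
      rw [h2, eq_neg_of_add_eq_zero_right h, smul_neg, smul_smul, neg_smul]
  obtain ⟨z, hez, -, hz⟩ := exists_perp_notMem Q (a • x + b • y) 0 (a • x + b • y) hV
  obtain ⟨b, hb, -⟩ := hQ.exists_isAdapted hV h0 he0 hz hez
  exact ⟨b, hb⟩

/-- Through each singular vector of a hyperbolic quadric there is a hyperbolic basis. -/
theorem IsHyperbolic.exists_isAdapted [Finite F] {Q : QuadraticForm F V} (hQ : IsHyperbolic Q)
    {e : V} (he : Q e = 0) (he0 : e ≠ 0) :
    ∃ b : Basis (Fin 4) F V, IsAdapted Q b ∧ b 0 = e ∧ Q (b 2) = 0 ∧ Q (b 3) = 0 := by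
  obtain ⟨hV, hns, L, hL2, hL⟩ := hQ
  have : FiniteDimensional F V := FiniteDimensional.of_finrank_pos (by omega)
  obtain ⟨z, hzL, hez, hz⟩ : ∃ z ∈ L, QuadraticMap.polar Q e z = 0 ∧
      z ∉ Submodule.span F {e} := by
    by_cases heL : e ∈ L
    · have h3 : ¬ L ≤ Submodule.span F {e} := by
        intro h
        have := Submodule.finrank_mono h
        have := finrank_span_singleton_le_one (F := F) e
        omega
      obtain ⟨z, hz, hze⟩ := SetLike.not_le_iff_exists.1 h3
      refine ⟨z, hz, ?_, hze⟩
      rw [QuadraticMap.polar, hL _ (L.add_mem heL hz), hL _ heL, hL _ hz]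
      simp
    · set φ := (QuadraticMap.polarBilin Q e).comp L.subtype with hφ
      have h1 := φ.finrank_range_add_finrank_ker
      have h2 : finrank F (LinearMap.range φ) ≤ 1 := by
        simpa using Submodule.finrank_le (LinearMap.range φ)
      have h3 : LinearMap.ker φ ≠ ⊥ := by
        intro h
        rw [h, finrank_bot, hL2] at h1
        omega
      obtain ⟨z, hz, hz0⟩ := Submodule.exists_mem_ne_zero_of_ne_bot h3
      refine ⟨z, z.2, by simpa [hφ] using hz, fun h => ?_⟩
      obtain ⟨a, ha⟩ := Submodule.mem_span_singleton.1 h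
      have ha0 : a ≠ 0 := by
        rintro rfl
        rw [zero_smul] at ha
        exact hz0 (Subtype.ext ha.symm)
      exact heL (by rw [← inv_smul_smul₀ ha0 e, ha]; exact L.smul_mem _ z.2)
  obtain ⟨b, hb, h0, h2, h3⟩ := hns.exists_isAdapted hV he he0 hz hez
  exact ⟨b, hb, h0, by rw [h2]; exact hL z hzL, h3 (hL z hzL)⟩

theorem IsHyperbolic.exists_hyperbolic_basis [Finite F] {Q : QuadraticForm F V}
    (hQ : IsHyperbolic Q) : ∃ b : Basis (Fin 4) F V, IsAdapted Q b ∧ Q (b 2) = 0 ∧ Q (b 3) = 0 := by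
  obtain ⟨L, hL2, hL⟩ := hQ.2.2
  have : L ≠ ⊥ := by rintro rfl; simp at hL2
  obtain ⟨e, he, he0⟩ := Submodule.exists_mem_ne_zero_of_ne_bot this
  obtain ⟨b, hb, -, h2, h3⟩ := hQ.exists_isAdapted (hL e he) he0
  exact ⟨b, hb, h2, h3⟩

/-- A quadratic form that vanishes on a hyperbolic quadric is a multiple of its form. -/
theorem IsHyperbolic.exists_eq_mul [Finite F] {Q Q' : QuadraticForm F V} (hQ : IsHyperbolic Q)
    (h : ∀ x, Q x = 0 → Q' x = 0) : ∃ c : F, ∀ x, Q' x = c * Q x := by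
  obtain ⟨b, hb, hb2, hb3⟩ := hQ.exists_hyperbolic_basis
  have hQb : ∀ x₀ x₁ x₂ x₃ : F, Q (x₀ • b 0 + x₁ • b 1 + x₂ • b 2 + x₃ • b 3) =
      x₀ * x₁ + x₂ * x₃ := by
    intro x₀ x₁ x₂ x₃
    rw [map_basis_four, hb.map_zero, hb.map_one, hb2, hb3, hb.polar01, hb.polar02, hb.polar03,
      hb.polar12, hb.polar13, hb.polar23]
    ring
  have hp : ∀ x y, Q x = 0 → Q y = 0 → QuadraticMap.polar Q x y = 0 →
      QuadraticMap.polar Q' x y = 0 := by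
    intro x y hx hy hxy
    rw [QuadraticMap.polar, h x hx, h y hy, h (x + y) (by rw [map_add_eq, hx, hy, hxy]; simp)]
    simp
  -- The only coefficients of `Q'` left are those of `x₀ x₁` and `x₂ x₃`; the singular vector with
  -- all coordinates 1 shows that they are equal.
  have h5 := h _ ((hQb 1 1 1 1).trans (by simp [CharTwo.add_self_eq_zero]))
  rw [map_basis_four, h _ hb.map_zero, h _ hb.map_one, h _ hb2, h _ hb3,
    hp _ _ hb.map_zero hb2 hb.polar02, hp _ _ hb.map_zero hb3 hb.polar03,
    hp _ _ hb.map_one hb2 hb.polar12, hp _ _ hb.map_one hb3 hb.polar13] at h5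
  simp only [one_mul, mul_zero, one_pow, add_zero, zero_add] at h5
  have h6 := CharTwo.add_eq_zero.1 h5
  refine ⟨QuadraticMap.polar Q' (b 0) (b 1), fun x => ?_⟩
  have hx := b.sum_repr x
  rw [Fin.sum_univ_four] at hx
  rw [← hx, hQb, map_basis_four, h _ hb.map_zero, h _ hb.map_one, h _ hb2, h _ hb3,
    hp _ _ hb.map_zero hb2 hb.polar02, hp _ _ hb.map_zero hb3 hb.polar03,
    hp _ _ hb.map_one hb2 hb.polar12, hp _ _ hb.map_one hb3 hb.polar13, ← h6]
  ring

end CharTwoQuadric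

/-! ### Lines and reguli of a hyperbolic quadric -/

section Lines

variable {F V : Type*} [Field F] [AddCommGroup V] [Module F V]

theorem polar_eq_zero_of_mem {Q : QuadraticForm F V} {L : Submodule F V} (hL : L ∈ quadricLines Q)
    {x y : V} (hx : x ∈ L) (hy : y ∈ L) : QuadraticMap.polar Q x y = 0 := by
  rw [QuadraticMap.polar, hL.2 _ (L.add_mem hx hy), hL.2 _ hx, hL.2 _ hy]
  simp

theorem exists_mem_polar_eq_zero (Q : QuadraticForm F V) {L : Submodule F V} (hL : finrank F L = 2)
    (p : V) : ∃ z ∈ L, z ≠ 0 ∧ QuadraticMap.polar Q p z = 0 := by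
  have : FiniteDimensional F L := FiniteDimensional.of_finrank_pos (by omega)
  set φ := (QuadraticMap.polarBilin Q p).comp L.subtype with hφ
  have h1 := φ.finrank_range_add_finrank_ker
  have h2 : finrank F (LinearMap.range φ) ≤ 1 := by
    simpa using Submodule.finrank_le (LinearMap.range φ)
  have h3 : LinearMap.ker φ ≠ ⊥ := by
    intro h
    rw [h, finrank_bot, hL] at h1
    omega
  obtain ⟨z, hz, hz0⟩ := Submodule.exists_mem_ne_zero_of_ne_bot h3
  exact ⟨z, z.2, by simpa using hz0, by simpa [hφ] using hz⟩

theorem exists_mem_notMem_span {L : Submodule F V} (hL : finrank F L = 2) (e : V) :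
    ∃ z ∈ L, z ∉ Submodule.span F {e} := by
  refine SetLike.not_le_iff_exists.1 fun h => ?_
  have : FiniteDimensional F (Submodule.span F {e}) := inferInstance
  have := Submodule.finrank_mono h
  have := finrank_span_singleton_le_one (F := F) e
  omega

theorem eq_span_pair_of_mem {L : Submodule F V} (hL : finrank F L = 2) {p x y : V} (hp : p ∈ L)
    (hp0 : p ≠ 0) (hx : x ∈ L) (hxp : x ∉ Submodule.span F {p})
    (hxy : x ∈ Submodule.span F {p, y}) : L = Submodule.span F {p, y} := by
  have hL' : FiniteDimensional F L := FiniteDimensional.of_finrank_pos (by omega)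
  have hli : LinearIndependent F ![p, x] := by
    rw [LinearIndependent.pair_iff' hp0]
    exact fun a ha => hxp (Submodule.mem_span_singleton.2 ⟨a, ha⟩)
  have h2 : finrank F (Submodule.span F (Set.range ![p, x])) = 2 := by
    simpa using finrank_span_eq_card hli
  have h3 : Submodule.span F (Set.range ![p, x]) = L := by
    refine Submodule.eq_of_le_of_finrank_eq (Submodule.span_le.2 ?_) (h2.trans hL.symm)
    simp [Set.insert_subset_iff, hp, hx]
  have hfd : FiniteDimensional F (Submodule.span F {p, y}) :=
    FiniteDimensional.span_of_finite F (Set.toFinite _)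
  refine Submodule.eq_of_le_of_finrank_le ?_ ?_
  · rw [← h3, Submodule.span_le]
    simp only [Matrix.range_cons, Matrix.range_empty, Set.union_empty, Set.singleton_union,
      Set.insert_subset_iff, Set.singleton_subset_iff, SetLike.mem_coe]
    exact ⟨Submodule.subset_span (by simp), hxy⟩
  · rw [hL]
    classical
    have h := (finrank_span_finset_le_card (R := F) ({p, y} : Finset V)).trans Finset.card_le_two
    rw [Set.finrank, Finset.coe_pair] at h
    exact h

/-- Through a singular vector there are two lines of a hyperbolic quadric, and they cover all
singular vectors that are orthogonal to it. -/
theorem IsHyperbolic.exists_two_lines [CharP F 2] [Finite F] {Q : QuadraticForm F V} (hQ : IsHyperbolic Q)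
    {p : V} (hp : Q p = 0) (hp0 : p ≠ 0) : ∃ A B : Submodule F V,
      (∀ x, Q x = 0 → QuadraticMap.polar Q p x = 0 → x ∈ A ∨ x ∈ B) ∧
      ∀ L ∈ quadricLines Q, p ∈ L → L = A ∨ L = B := by
  obtain ⟨b, hb, rfl, h2, h3⟩ := hQ.exists_isAdapted hp hp0
  have hcov : ∀ x, Q x = 0 → QuadraticMap.polar Q (b 0) x = 0 →
      x ∈ Submodule.span F {b 0, b 2} ∨ x ∈ Submodule.span F {b 0, b 3} := by
    intro x hx hpx
    have hr := b.sum_repr x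
    rw [Fin.sum_univ_four] at hr
    have h1 : b.repr x 1 = 0 := by
      rw [← hr] at hpx
      simpa [-QuadraticMap.polar_self, QuadraticMap.polar_add_right, QuadraticMap.polar_smul_right,
        polar_self_eq_zero, hb.polar01, hb.polar02, hb.polar03] using hpx
    rw [h1, zero_smul, add_zero] at hr
    have h23 : b.repr x 2 * b.repr x 3 = 0 := by
      have := map_basis_four Q b (b.repr x 0) 0 (b.repr x 2) (b.repr x 3)
      rw [zero_smul, add_zero, hr, hx, hb.map_zero, h2, h3, hb.polar02, hb.polar03,
        hb.polar23] at this
      simpa using this.symm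
    simp only [Submodule.mem_span_pair]
    rcases mul_eq_zero.1 h23 with h | h
    · right
      rw [h, zero_smul, add_zero] at hr
      exact ⟨_, _, hr⟩
    · left
      rw [h, zero_smul, add_zero] at hr
      exact ⟨_, _, hr⟩
  refine ⟨_, _, hcov, fun L hL hpL => ?_⟩
  obtain ⟨x, hx, hxp⟩ := exists_mem_notMem_span hL.1 (b 0)
  rcases hcov x (hL.2 x hx) (polar_eq_zero_of_mem hL hpL hx) with h | h
  · exact Or.inl (eq_span_pair_of_mem hL.1 hpL hp0 hx hxp h)
  · exact Or.inr (eq_span_pair_of_mem hL.1 hpL hp0 hx hxp h)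

/-- Being equal or disjoint is a transitive relation on the lines of a hyperbolic quadric. -/
theorem IsHyperbolic.eq_or_disjoint_trans [CharP F 2] [Finite F] {Q : QuadraticForm F V} (hQ : IsHyperbolic Q)
    {L M N : Submodule F V} (hL : L ∈ quadricLines Q) (hM : M ∈ quadricLines Q)
    (hN : N ∈ quadricLines Q) (hNM : N = M ∨ Disjoint N M) (hML : M = L ∨ Disjoint M L) :
    N = L ∨ Disjoint N L := by
  rcases hNM with rfl | hNM
  · exact hML
  rcases hML with rfl | hML
  · exact Or.inr hNM
  rw [or_iff_not_imp_right]
  intro hNL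
  rw [Submodule.disjoint_def] at hNL hNM hML
  push Not at hNL
  obtain ⟨p, hpN, hpL, hp0⟩ := hNL
  -- If `L` and `N` were distinct lines through `p`, they would be `A` and `B`, so the point `r` of
  -- `M` orthogonal to `p` would lie on one of them, although `M` is skew to both.
  obtain ⟨A, B, hcov, hAB⟩ := hQ.exists_two_lines (hL.2 p hpL) hp0
  obtain ⟨r, hrM, hr0, hr⟩ := exists_mem_polar_eq_zero Q hM.1 p
  have h1 := hAB L hL hpL
  have h2 := hAB N hN hpN
  have h3 := hcov r (hM.2 r hrM) hr
  have h4 : r ∉ L := fun h => hr0 (hML r hrM h)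
  have h5 : r ∉ N := fun h => hr0 (hNM r h hrM)
  rcases h1 with rfl | rfl <;> rcases h2 with rfl | rfl <;> tauto

theorem IsHyperbolic.regulusOf_eq [CharP F 2] [Finite F] {Q : QuadraticForm F V} (hQ : IsHyperbolic Q)
    {L M : Submodule F V} (hL : L ∈ quadricLines Q) (hM : M ∈ quadricLines Q)
    (hML : M = L ∨ Disjoint M L) : regulusOf Q M = regulusOf Q L := by
  have hLM : L = M ∨ Disjoint L M := hML.imp Eq.symm fun h => h.symm
  ext N
  exact ⟨fun hN => ⟨hN.1, hQ.eq_or_disjoint_trans hL hM hN.1 hN.2 hML⟩,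
    fun hN => ⟨hN.1, hQ.eq_or_disjoint_trans hM hL hN.1 hN.2 hLM⟩⟩

end Lines

/-! ### Anisotropic planes as lines over a quadratic extension field -/

section AnisotropicPlane

variable {F E : Type*} [Field F] [AddCommGroup E] [Module F E]
  {q : QuadraticForm F E}

/-- Orthogonal vectors have a singular combination, which anisotropy turns into a linear dependence.
-/
theorem mem_span_of_polar_eq_zero [CharP F 2] [Finite F] (hq : ∀ x, q x = 0 → x = 0) {x y : E} (hx : x ≠ 0)
    (hxy : QuadraticMap.polar q x y = 0) : y ∈ Submodule.span F {x} := by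
  obtain ⟨a, b, hab, h0⟩ := exists_singular_comb q x y hxy
  have h1 := hq _ h0
  have hb : b ≠ 0 := by
    rintro rfl
    have ha : a ≠ 0 := by simpa using hab
    rw [zero_smul, add_zero] at h1
    exact smul_ne_zero ha hx h1
  refine Submodule.mem_span_singleton.2 ⟨-(b⁻¹ * a), ?_⟩
  have h2 : y = b⁻¹ • (b • y) := by rw [inv_smul_smul₀ hb]
  rw [h2, eq_neg_of_add_eq_zero_right h1, smul_neg, smul_smul, neg_smul]

/-- A vector outside the span of a given one. -/
theorem exists_notMem_span (hE : finrank F E = 2) (x : E) : ∃ y, y ∉ Submodule.span F {x} := by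
  obtain ⟨y, -, hy⟩ := exists_mem_notMem_span (F := F) (L := (⊤ : Submodule F E))
    (by rw [finrank_top, hE]) x
  exact ⟨y, hy⟩

theorem polar_injective [CharP F 2] [Finite F] (hq : ∀ x, q x = 0 → x = 0) (hE : finrank F E = 2) {x : E}
    (hx : ∀ y, QuadraticMap.polar q x y = 0) : x = 0 := by
  by_contra hx0
  obtain ⟨y, hy⟩ := exists_notMem_span (F := F) hE x
  exact hy (mem_span_of_polar_eq_zero hq hx0 (hx y))

/-- `κ` has a trace with respect to `q`; these endomorphisms form a quadratic extension field. -/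
def HasTrace (q : QuadraticForm F E) (κ : Module.End F E) : Prop :=
  ∃ c : F, ∀ x, QuadraticMap.polar q (κ x) x = c * q x

theorem HasTrace.add {κ μ : Module.End F E} (hκ : HasTrace q κ) (hμ : HasTrace q μ) :
    HasTrace q (κ + μ) := by
  obtain ⟨c, hc⟩ := hκ
  obtain ⟨d, hd⟩ := hμ
  exact ⟨c + d, fun x => by rw [LinearMap.add_apply, QuadraticMap.polar_add_left, hc, hd, add_mul]⟩

theorem HasTrace.smul {κ : Module.End F E} (a : F) (hκ : HasTrace q κ) : HasTrace q (a • κ) := by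
  obtain ⟨c, hc⟩ := hκ
  exact ⟨a * c, fun x => by
    rw [LinearMap.smul_apply, QuadraticMap.polar_smul_left, hc, smul_eq_mul, mul_assoc]⟩

theorem hasTrace_one [CharP F 2] : HasTrace q (1 : Module.End F E) :=
  ⟨0, fun x => by rw [Module.End.one_apply, polar_self_eq_zero, zero_mul]⟩

theorem polar_add_polar {κ : Module.End F E} {c : F}
    (hc : ∀ x, QuadraticMap.polar q (κ x) x = c * q x) (x y : E) :
    QuadraticMap.polar q (κ x) y + QuadraticMap.polar q (κ y) x =
      c * QuadraticMap.polar q x y := by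
  have h := hc (x + y)
  rw [map_add, QuadraticMap.polar_add_left, QuadraticMap.polar_add_right,
    QuadraticMap.polar_add_right, hc, hc, map_add_eq] at h
  linear_combination h

/-- This is what makes the algebra of such endomorphisms a field. A kernel vector `x` forces the
trace `c` to be 0; then the image is orthogonal to `x`, so it lies on the line of `x`, and `κ y` is
orthogonal to `y` as well. -/
theorem HasTrace.eq_zero [CharP F 2] [Finite F] (hq : ∀ x, q x = 0 → x = 0) {κ : Module.End F E}
    (hκ : HasTrace q κ) {x : E} (hx0 : x ≠ 0) (hx : κ x = 0) : κ = 0 := by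
  obtain ⟨c, hc⟩ := hκ
  have hqx : q x ≠ 0 := fun h => hx0 (hq x h)
  have hc0 : c = 0 := by
    have := hc x
    rw [hx, QuadraticMap.polar_zero_left] at this
    exact (mul_eq_zero.1 this.symm).resolve_right hqx
  have hspan : ∀ y, κ y ∈ Submodule.span F {x} := by
    intro y
    have := polar_add_polar hc x y
    rw [hx, QuadraticMap.polar_zero_left, hc0, zero_mul, zero_add, QuadraticMap.polar_comm] at this
    exact mem_span_of_polar_eq_zero hq hx0 this
  ext y
  by_cases hy : y ∈ Submodule.span F {x}
  · obtain ⟨a, rfl⟩ := Submodule.mem_span_singleton.1 hy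
    rw [map_smul, hx, smul_zero, LinearMap.zero_apply]
  · obtain ⟨a, ha⟩ := Submodule.mem_span_singleton.1 (hspan y)
    have h1 := hc y
    rw [hc0, zero_mul, ← ha, QuadraticMap.polar_smul_left, smul_eq_mul] at h1
    rcases mul_eq_zero.1 h1 with h | h
    · rw [← ha, h, zero_smul, LinearMap.zero_apply]
    · exact absurd (mem_span_of_polar_eq_zero hq hx0 h) hy

/-- There is an endomorphism of trace one. -/
theorem exists_trace_one [CharP F 2] [Finite F] (hq : ∀ x, q x = 0 → x = 0) (hE : finrank F E = 2) :
    ∃ A : Module.End F E, ∀ x, QuadraticMap.polar q (A x) x = q x := by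
  have : FiniteDimensional F E := FiniteDimensional.of_finrank_pos (by omega)
  -- `M` is a bilinear form, in general not symmetric, with diagonal `q`; dividing it by the
  -- nondegenerate polar form gives the endomorphism.
  obtain ⟨M, hM⟩ := LinearMap.BilinMap.toQuadraticMap_surjective q
  let P : E →ₗ[F] Module.Dual F E := QuadraticMap.polarBilin q
  have hP : Function.Injective P := by
    rw [← LinearMap.ker_eq_bot, LinearMap.ker_eq_bot']
    intro x hx
    exact polar_injective hq hE fun y => by simpa [P] using congrArg (fun f => f y) hx
  let P' := LinearMap.linearEquivOfInjective P hP (Subspace.dual_finrank_eq).symm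
  refine ⟨P'.symm.toLinearMap ∘ₗ M, fun x => ?_⟩
  have h1 : P (P'.symm (M x)) = M x := by
    rw [← LinearMap.linearEquivOfInjective_apply (f := P) (hf := hP)
      (hdim := (Subspace.dual_finrank_eq).symm)]
    exact P'.apply_symm_apply _
  have h2 := congrArg (fun f => f x) h1
  rw [← hM, LinearMap.BilinMap.toQuadraticMap_apply, ← h2, hM]
  rfl

/-- A pair of vectors spans a plane. -/
theorem exists_comb_of_notMem_span (hE : finrank F E = 2) {x y : E} (hx : x ≠ 0)
    (hy : y ∉ Submodule.span F {x}) (z : E) : ∃ a b : F, z = a • x + b • y := by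
  have h := eq_span_pair_of_mem (F := F) (L := (⊤ : Submodule F E)) (by rw [finrank_top, hE])
    (Submodule.mem_top (x := x)) hx (Submodule.mem_top (x := y)) hy
    (Submodule.subset_span (by simp : y ∈ ({x, y} : Set E)))
  have hz : z ∈ Submodule.span F {x, y} := h ▸ Submodule.mem_top
  obtain ⟨a, b, hab⟩ := Submodule.mem_span_pair.1 hz
  exact ⟨a, b, hab.symm⟩

theorem notMem_span_of_trace_one [CharP F 2] (hq : ∀ x, q x = 0 → x = 0) {A : Module.End F E}
    (hA : ∀ x, QuadraticMap.polar q (A x) x = q x) {x : E} (hx : x ≠ 0) :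
    A x ∉ Submodule.span F {x} := by
  intro h
  obtain ⟨a, ha⟩ := Submodule.mem_span_singleton.1 h
  have := hA x
  rw [← ha, QuadraticMap.polar_smul_left, polar_self_eq_zero, smul_zero] at this
  exact hx (hq x this.symm)

/-- Since `x` and `A x` span the plane, some combination of `1` and `A` agrees with `κ` at `x`; the
difference has a trace and a kernel, so it is zero. -/
theorem HasTrace.eq_comb [CharP F 2] [Finite F] (hq : ∀ x, q x = 0 → x = 0) (hE : finrank F E = 2)
    {A : Module.End F E} (hA : ∀ x, QuadraticMap.polar q (A x) x = q x) {κ : Module.End F E}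
    (hκ : HasTrace q κ) : ∃ a b : F, κ = a • 1 + b • A := by
  obtain ⟨x, hx⟩ := exists_notMem_span (F := F) hE 0
  have hx0 : x ≠ 0 := by rintro rfl; exact hx (Submodule.zero_mem _)
  obtain ⟨a, b, hab⟩ :=
    exists_comb_of_notMem_span hE hx0 (notMem_span_of_trace_one hq hA hx0) (κ x)
  refine ⟨a, b, ?_⟩
  have hA' : HasTrace q A := ⟨1, fun x => by rw [hA, one_mul]⟩
  have h := (hκ.add (((hasTrace_one.smul a).add (hA'.smul b)).smul (-1))).eq_zero hq hx0
    (by simp [hab]; abel)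
  rw [neg_one_smul] at h
  exact add_neg_eq_zero.1 h

theorem hasTrace_mul_self [CharP F 2] {A : Module.End F E}
    (hA : ∀ x, QuadraticMap.polar q (A x) x = q x) : HasTrace q (A * A) := by
  refine ⟨1, fun x => ?_⟩
  -- Polarising the trace identity at `x` and `A x` computes the trace of `A * A`, since `polar (A
  -- x) (A x)` vanishes.
  have h := polar_add_polar (κ := A) (c := 1) (fun x => by rw [hA, one_mul]) x (A x)
  rw [polar_self_eq_zero, zero_add, one_mul, QuadraticMap.polar_comm q x, hA] at h
  rw [Module.End.mul_apply, h, one_mul]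

/-- The endomorphisms with a trace form a commutative subalgebra. -/
theorem exists_subalgebra_hasTrace [CharP F 2] [Finite F] (hq : ∀ x, q x = 0 → x = 0) (hE : finrank F E = 2) :
    ∃ K : Subalgebra F (Module.End F E), (∀ κ, κ ∈ K ↔ HasTrace q κ) ∧
      (∀ κ ∈ K, ∀ μ ∈ K, κ * μ = μ * κ) ∧ ∀ x y : E, x ≠ 0 → ∃ κ ∈ K, κ x = y := by
  obtain ⟨A, hA⟩ := exists_trace_one hq hE
  have hA' : HasTrace q A := ⟨1, fun x => by rw [hA, one_mul]⟩
  have h0 : HasTrace q (0 : Module.End F E) := by simpa using hasTrace_one.smul (q := q) 0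
  refine ⟨{ carrier := {κ | HasTrace q κ}
            mul_mem' := ?_
            one_mem' := hasTrace_one
            add_mem' := fun h h' => h.add h'
            zero_mem' := h0
            algebraMap_mem' := fun a => ?_ }, fun κ => Iff.rfl, ?_, fun x y hx => ?_⟩
  · intro κ μ hκ hμ
    obtain ⟨a, b, rfl⟩ := HasTrace.eq_comb hq hE hA hκ
    obtain ⟨c, d, rfl⟩ := HasTrace.eq_comb hq hE hA hμ
    have h : (a • 1 + b • A) * (c • 1 + d • A) =
        (a * c) • 1 + (a * d + b * c) • A + (b * d) • (A * A) := by
      simp only [add_mul, mul_add, smul_mul_assoc, mul_smul_comm, one_mul, mul_one]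
      module
    show HasTrace q _
    rw [h]
    exact ((hasTrace_one.smul _).add (hA'.smul _)).add ((hasTrace_mul_self hA).smul _)
  · rw [Algebra.algebraMap_eq_smul_one]
    exact hasTrace_one.smul a
  · intro κ hκ μ hμ
    obtain ⟨a, b, rfl⟩ := HasTrace.eq_comb hq hE hA hκ
    obtain ⟨c, d, rfl⟩ := HasTrace.eq_comb hq hE hA hμ
    simp only [add_mul, mul_add, smul_mul_assoc, mul_smul_comm, one_mul, mul_one]
    module
  · obtain ⟨a, b, hab⟩ := exists_comb_of_notMem_span hE hx (notMem_span_of_trace_one hq hA hx) y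
    exact ⟨a • 1 + b • A, (hasTrace_one.smul a).add (hA'.smul b), by simp [hab]⟩

/-- Conjugation of endomorphisms with a bijective semilinear map. -/
def semilinearConj (t : E ≃+ E)
    (σ : F ≃+* F) (ht : ∀ (a : F) (x : E), t (a • x) = σ a • t x) :
    Module.End F E →* Module.End F E where
  toFun κ :=
    { toFun := fun x => t (κ (t.symm x))
      map_add' := fun x y => by simp
      map_smul' := fun a x => by
        have h : t.symm (a • x) = σ.symm a • t.symm x := by
          rw [AddEquiv.symm_apply_eq, ht]; simp
        rw [h, map_smul, ht]; simp }
  map_one' := by ext x; simp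
  map_mul' κ μ := by ext x; simp

theorem semilinearConj_apply (t : E ≃+ E)
    (σ : F ≃+* F) (ht : ∀ (a : F) (x : E), t (a • x) = σ a • t x) (κ : Module.End F E) (x : E) :
    semilinearConj t σ ht κ (t x) = t (κ x) := by
  simp [semilinearConj]

theorem polar_semisimilitude {t : E → E} (hadd : ∀ x y, t (x + y) = t x + t y) {σ : F →+* F}
    {a : F} (hqt : ∀ x, q (t x) = a * σ (q x)) (x y : E) :
    QuadraticMap.polar q (t x) (t y) = a * σ (QuadraticMap.polar q x y) := by
  rw [QuadraticMap.polar, QuadraticMap.polar, ← hadd, hqt, hqt, hqt, map_sub, map_sub]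
  ring

theorem HasTrace.semilinearConj {t : E ≃+ E} {σ : F ≃+* F}
    (ht : ∀ (a : F) (x : E), t (a • x) = σ a • t x) {a : F}
    (hqt : ∀ x, q (t x) = a * σ (q x)) {κ : Module.End F E} (hκ : HasTrace q κ) :
    HasTrace q (semilinearConj t σ ht κ) := by
  obtain ⟨c, hc⟩ := hκ
  refine ⟨σ c, fun x => ?_⟩
  obtain ⟨x, rfl⟩ := t.surjective x
  rw [semilinearConj_apply, polar_semisimilitude (σ := (σ : F →+* F)) (map_add t) hqt, hc, hqt]
  simp only [map_mul, RingEquiv.coe_toRingHom]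
  ring

/-- Two semilinear similitudes of an anisotropic plane that commute on one nonzero vector
commute. -/
theorem semisimilitude_comm [CharP F 2] [Finite F] (hq : ∀ x, q x = 0 → x = 0) (hE : finrank F E = 2) {s t : E ≃+ E}
    {ρ σ : F ≃+* F} (hs : ∀ (a : F) (x : E), s (a • x) = ρ a • s x)
    (ht : ∀ (a : F) (x : E), t (a • x) = σ a • t x) {a b : F}
    (hqs : ∀ x, q (s x) = a * ρ (q x)) (hqt : ∀ x, q (t x) = b * σ (q x)) {x₀ : E} (hx₀ : x₀ ≠ 0)
    (h : t (s x₀) = s (t x₀)) (x : E) : t (s x) = s (t x) := by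
  have : FiniteDimensional F E := FiniteDimensional.of_finrank_pos (by omega)
  have : Finite E := Module.finite_of_finite F
  have : Finite (Module.End F E) := Finite.of_injective _ DFunLike.coe_injective
  obtain ⟨K, hK, hcomm, htrans⟩ := exists_subalgebra_hasTrace hq hE
  let iC : CommRing K := { (inferInstance : Ring K) with
    mul_comm := fun κ μ => Subtype.ext (hcomm κ κ.2 μ μ.2) }
  have iN : Nontrivial K := by
    have : Nontrivial E := ⟨x₀, 0, hx₀⟩
    infer_instance
  have iNZ : NoZeroDivisors K := by
    refine ⟨fun {κ μ} hκμ => or_iff_not_imp_right.2 fun hμ => ?_⟩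
    have hμ' : (μ : Module.End F E) x₀ ≠ 0 := fun h0 =>
      hμ (Subtype.ext (((hK μ).1 μ.2).eq_zero hq hx₀ h0))
    refine Subtype.ext (((hK κ).1 κ.2).eq_zero hq hμ' ?_)
    have := congrArg (fun ν : K => (ν : Module.End F E) x₀) hκμ
    exact this
  have iD : IsDomain K := NoZeroDivisors.to_isDomain K
  -- Conjugation by a semilinear similitude preserves `K`, hence induces an endomorphism of the
  -- cyclic group `Kˣ`, which is a power map.
  have key : ∀ (t : E ≃+ E) (σ : F ≃+* F), (∀ (a : F) (x : E), t (a • x) = σ a • t x) →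
      ∀ a : F, (∀ x, q (t x) = a * σ (q x)) →
      ∃ m : ℤ, ∀ (g : Kˣ) (x : E), t (((g : K) : Module.End F E) x) =
        (((g ^ m : Kˣ) : K) : Module.End F E) (t x) := by
    intro t σ ht a hqt
    let φ : K →* K :=
      { toFun := fun κ => ⟨semilinearConj t σ ht κ,
          (hK _).2 (((hK _).1 κ.2).semilinearConj ht hqt)⟩
        map_one' := Subtype.ext (map_one (semilinearConj t σ ht))
        map_mul' := fun κ μ => Subtype.ext (map_mul (semilinearConj t σ ht) κ.1 μ.1) }
    obtain ⟨m, hm⟩ := MonoidHom.map_cyclic (Units.map φ)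
    refine ⟨m, fun g x => ?_⟩
    rw [← hm g, ← semilinearConj_apply t σ ht]
    rfl
  obtain ⟨m, hm⟩ := key s ρ hs a hqs
  obtain ⟨n, hn⟩ := key t σ ht b hqt
  by_cases hx : x = 0
  · simp [hx]
  -- With `x = g x₀` for a unit `g` of `K`, the two sides become `g ^ (m * n)` applied to `t (s x₀)`
  -- and to `s (t x₀)`.
  obtain ⟨κ, hκ, rfl⟩ := htrans x₀ x hx₀
  have hκ0 : (⟨κ, hκ⟩ : K) ≠ 0 := by
    intro h0
    have : κ = 0 := congrArg Subtype.val h0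
    exact hx (by rw [this, LinearMap.zero_apply])
  obtain ⟨g, hg⟩ : IsUnit (⟨κ, hκ⟩ : K) := by
    obtain ⟨ν, hν⟩ := (Finite.isDomain_to_isField K).mul_inv_cancel hκ0
    exact IsUnit.of_mul_eq_one ν hν
  have hg' : κ = ((g : K) : Module.End F E) := by rw [hg]
  rw [hg', hm, hn, hn, hm, h, ← zpow_mul, ← zpow_mul, mul_comm]

end AnisotropicPlane

/-! ### Maps proportional on the singular vectors of an adapted form -/

section Eigen

variable {K F W X : Type*} [Field K] [CharP K 2] [Field F] [Algebra K F] [AddCommGroup W]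
  [Module K W] [AddCommGroup X] [Module K X] [Module F X] [IsScalarTower K F X]

/-- The singular vectors of a quadratic form with an adapted basis contain a frame: two linear maps
over a subfield that are proportional on each singular vector are proportional. -/
theorem IsAdapted.exists_eq_smul {Q : QuadraticForm K W} {b : Basis (Fin 4) K W}
    (hb : IsAdapted Q b) {f i : W →ₗ[K] X} (hi : LinearIndependent F fun j => i (b j))
    (hf : ∀ w, Q w = 0 → ∃ c : F, f w = c • i w) : ∃ c : F, ∀ w, f w = c • i w := by
  obtain ⟨c, hc⟩ := hf _ hb.map_zero
  obtain ⟨d, hd⟩ := hf _ hb.map_one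
  -- For every `z` orthogonal to the first pair this supplies a singular vector. The choices `b 2`,
  -- `b 3` and `b 2 + b 3`, together with `b 0` and `b 1`, serve as the frame.
  have hsing : ∀ z, QuadraticMap.polar Q (b 0) z = 0 → QuadraticMap.polar Q (b 1) z = 0 →
      Q (b 0 + z + Q z • b 1) = 0 := by
    intro z h0 h1
    rw [map_add_eq, map_add_eq, map_smul_eq, hb.map_zero, hb.map_one, h0,
      QuadraticMap.polar_smul_right, QuadraticMap.polar_add_left, hb.polar01,
      QuadraticMap.polar_comm Q z, h1]
    simp [CharTwo.add_self_eq_zero]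
  have hz : ∀ z, QuadraticMap.polar Q (b 0) z = 0 → QuadraticMap.polar Q (b 1) z = 0 →
      ∃ n : F, f z = n • (i (b 0) + i z + (algebraMap K F (Q z)) • i (b 1)) - c • i (b 0) -
        (algebraMap K F (Q z) * d) • i (b 1) := by
    intro z h0 h1
    obtain ⟨n, hn⟩ := hf _ (hsing z h0 h1)
    refine ⟨n, ?_⟩
    rw [map_add, map_add, map_smul, map_add, map_add, map_smul, hc, hd,
      ← algebraMap_smul F (Q z), ← algebraMap_smul F (Q z) (i (b 1)), smul_smul] at hn
    rw [← hn]
    abel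
  obtain ⟨n₂, h₂⟩ := hz (b 2) hb.polar02 hb.polar12
  obtain ⟨n₃, h₃⟩ := hz (b 3) hb.polar03 hb.polar13
  obtain ⟨n₄, h₄⟩ := hz (b 2 + b 3)
    (by rw [QuadraticMap.polar_add_right, hb.polar02, hb.polar03, add_zero])
    (by rw [QuadraticMap.polar_add_right, hb.polar12, hb.polar13, add_zero])
  rw [map_add, map_add, h₂, h₃, map_add_eq, hb.polar23, map_add, map_add,
    (algebraMap K F).map_one] at h₄
  -- Additivity on `b 2 + b 3` gives one relation between independent vectors. The extra 1 in `Q (b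
  -- 2 + b 3) = Q (b 2) + Q (b 3) + 1` is what forces `d = c`.
  set α := algebraMap K F (Q (b 2))
  set β := algebraMap K F (Q (b 3))
  rw [Fintype.linearIndependent_iff] at hi
  have h := hi ![n₂ - c + (n₃ - c) - (n₄ - c),
    (n₂ * α - α * d) + (n₃ * β - β * d) - (n₄ * (α + β + 1) - (α + β + 1) * d),
    n₂ - n₄, n₃ - n₄] (by
      rw [Fin.sum_univ_four]
      simp only [Matrix.cons_val]
      rw [← sub_eq_zero] at h₄
      rw [← h₄]
      module)
  have e0 : n₂ - c + (n₃ - c) - (n₄ - c) = 0 := h 0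
  have e1 : (n₂ * α - α * d) + (n₃ * β - β * d) - (n₄ * (α + β + 1) - (α + β + 1) * d) = 0 := h 1
  have e2 : n₂ - n₄ = 0 := h 2
  have e3 : n₃ - n₄ = 0 := h 3
  have f2 : n₂ = c := by linear_combination e0 - e3
  have f3 : n₃ = c := by linear_combination e0 - e2
  have f4 : n₄ = c := by linear_combination e0 - e2 - e3
  have f1 : d = c := by
    rw [f2, f3, f4] at e1
    linear_combination e1
  refine ⟨c, fun w => ?_⟩
  have hb' : ∀ j, f (b j) = c • i (b j) := by
    intro j
    fin_cases j
    · exact hc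
    · exact f1 ▸ hd
    · refine h₂.trans ?_
      rw [f2, f1]
      show _ = c • i (b 2)
      module
    · refine h₃.trans ?_
      rw [f3, f1]
      show _ = c • i (b 3)
      module
  conv_lhs => rw [← b.sum_repr w]
  conv_rhs => rw [← b.sum_repr w]
  rw [map_sum, map_sum, Finset.smul_sum]
  refine Finset.sum_congr rfl fun j _ => ?_
  rw [map_smul, map_smul, hb', smul_comm]

end Eigen

/-! ### The quadratic extension of finite fields -/

section Subfield

variable {F : Type*} [Field F] [CharP F 2] {k : ℕ}

theorem mem_subfieldGF {a : F} : a ∈ subfieldGF F k ↔ a ^ 2 ^ k = a := Iff.rfl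

theorem pow_pow_eq {F : Type*} [Field F] {k : ℕ} (hF : Nat.card F = (2 ^ k) ^ 2) (a : F) : (a ^ 2 ^ k) ^ 2 ^ k = a := by
  have : Finite F := Nat.finite_of_card_ne_zero (by rw [hF]; positivity)
  have := Fintype.ofFinite F
  rw [← pow_mul, ← sq, ← hF, Nat.card_eq_fintype_card, FiniteField.pow_card]

/-- The relative trace is onto the subfield. -/
theorem exists_add_pow_eq (hk : 0 < k) (hF : Nat.card F = (2 ^ k) ^ 2) {c : F}
    (hc : c ^ 2 ^ k = c) : ∃ t : F, t + t ^ 2 ^ k = c := by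
  have : Finite F := Nat.finite_of_card_ne_zero (by rw [hF]; positivity)
  have h2 : 2 ≤ 2 ^ k := by
    calc 2 = 2 ^ 1 := rfl
      _ ≤ 2 ^ k := Nat.pow_le_pow_right (by norm_num) hk
  -- A unit outside the subfield has nonzero trace, and multiplying it by subfield elements reaches
  -- every `c`.
  obtain ⟨g, hg⟩ := exists_pow_ne_one_of_isCyclic (G := Fˣ) (k := 2 ^ k - 1) (by omega) (by
    rw [Nat.card_units, hF]
    have : 2 ^ k * 2 ≤ (2 ^ k) ^ 2 := by rw [sq]; exact Nat.mul_le_mul_left _ h2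
    omega)
  have hu : (g : F) + (g : F) ^ 2 ^ k ≠ 0 := by
    intro h
    apply hg
    have h1 : g ^ 2 ^ k = g := Units.ext (by
      rw [Units.val_pow_eq_pow_val]; exact (CharTwo.add_eq_zero.1 h).symm)
    have h3 : g ^ (2 ^ k - 1) * g = 1 * g := by
      rw [← pow_succ, Nat.sub_add_cancel (by omega), h1, one_mul]
    exact mul_right_cancel h3
  obtain ⟨d, hd⟩ : ∃ d, d = (g : F) + (g : F) ^ 2 ^ k := ⟨_, rfl⟩
  have hdq : d ^ 2 ^ k = d := by
    rw [hd, add_pow_char_pow, pow_pow_eq hF, add_comm]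
  refine ⟨c / d * g, ?_⟩
  rw [mul_pow, div_pow, hc, hdq, ← mul_add, ← hd, div_mul_cancel₀]
  rw [hd]; exact hu

end Subfield

/-! ### Subgeometries and their Baer involutions -/

section Subgeometry

variable {F V : Type*} [Field F] [CharP F 2] [AddCommGroup V] [Module F V] {k : ℕ}

/-- Additive maps that are semilinear for the same map agree if they agree on a spanning set. -/
theorem semilinear_ext {F V Y : Type*} [Field F] [AddCommGroup V] [Module F V] [AddCommGroup Y]
    [Module F Y] {S : Set V} (hS : Submodule.span F S = ⊤) {φ : F → F} {f g : V →+ Y}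
    (hf : ∀ (a : F) (x : V), f (a • x) = φ a • f x) (hg : ∀ (a : F) (x : V), g (a • x) = φ a • g x)
    (h : ∀ x ∈ S, f x = g x) (x : V) : f x = g x := by
  have hx : x ∈ Submodule.span F S := hS ▸ Submodule.mem_top
  induction hx using Submodule.span_induction with
  | mem x hx => exact h x hx
  | zero => rw [map_zero, map_zero]
  | add x y _ _ hx hy => rw [map_add, map_add, hx, hy]
  | smul a x _ hx => rw [hf, hg, hx]

theorem exists_basis_coe (hV : finrank F V = 4) {W : Submodule (subfieldGF F k) V}
    (hW : Submodule.span F (W : Set V) = ⊤) (b : Basis (Fin 4) (subfieldGF F k) W) :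
    ∃ b' : Basis (Fin 4) F V, ∀ j, b' j = b j := by
  have h : ⊤ ≤ Submodule.span F (Set.range fun j => (b j : V)) := by
    rw [← hW, Submodule.span_le]
    intro w hw
    have h1 := congrArg Subtype.val (b.sum_repr ⟨w, hw⟩)
    simp only [Submodule.coe_sum, Submodule.coe_smul] at h1
    rw [← h1]
    exact Submodule.sum_mem _ fun j _ => Submodule.smul_mem _ (b.repr ⟨w, hw⟩ j : F)
      (Submodule.subset_span ⟨j, rfl⟩)
  exact ⟨basisOfTopLeSpanOfCardEqFinrank _ h (by simp [hV]), fun j => by simp⟩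

/-- The Baer involution fixing a subgeometry. -/
theorem exists_baer_involution (hF : Nat.card F = (2 ^ k) ^ 2) (hV : finrank F V = 4)
    {W : Submodule (subfieldGF F k) V} (hW4 : finrank (subfieldGF F k) W = 4)
    (hW : Submodule.span F (W : Set V) = ⊤) :
    ∃ τ : V →+ V, (∀ (a : F) (x : V), τ (a • x) = a ^ 2 ^ k • τ x) ∧ (∀ x, τ (τ x) = x) ∧
      ∀ x, τ x = x ↔ x ∈ W := by
  have : FiniteDimensional (subfieldGF F k) W := FiniteDimensional.of_finrank_pos (by omega)
  obtain ⟨b, hb⟩ := exists_basis_coe hV hW (finBasisOfFinrankEq _ _ hW4)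
  have hbW : ∀ j, b j ∈ W := fun j => hb j ▸ Subtype.prop _
  let τ : V →+ V :=
    { toFun := fun x => ∑ j, (b.repr x j) ^ 2 ^ k • b j
      map_zero' := by simp
      map_add' := fun x y => by
        simp [add_pow_char_pow, add_smul, Finset.sum_add_distrib] }
  have hτ : ∀ x, τ x = ∑ j, (b.repr x j) ^ 2 ^ k • b j := fun x => rfl
  have hrepr : ∀ x j, b.repr (τ x) j = b.repr x j ^ 2 ^ k := by
    intro x j
    rw [hτ, b.repr_sum_self]
  refine ⟨τ, fun a x => ?_, fun x => ?_, fun x => ⟨fun hx => ?_, fun hx => ?_⟩⟩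
  · rw [hτ, hτ, Finset.smul_sum]
    simp [mul_pow, smul_smul]
  · refine b.repr.injective (Finsupp.ext fun j => ?_)
    rw [hrepr, hrepr, pow_pow_eq hF]
  · rw [← b.sum_repr x]
    refine W.sum_mem fun j _ => ?_
    have hj : b.repr x j ∈ subfieldGF F k := mem_subfieldGF.2 (by rw [← hrepr, hx])
    exact W.smul_mem (⟨_, hj⟩ : subfieldGF F k) (hbW j)
  · have hj : ∀ j, b.repr x j ^ 2 ^ k = b.repr x j := by
      intro j
      have h1 := congrArg Subtype.val ((finBasisOfFinrankEq _ _ hW4).sum_repr ⟨x, hx⟩)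
      simp only [Submodule.coe_sum, Submodule.coe_smul, ← hb] at h1
      rw [← h1]
      simp only [Subfield.smul_def]
      rw [b.repr_sum_self]
      exact mem_subfieldGF.1 (Subtype.prop _)
    rw [hτ]
    simp only [hj]
    exact b.sum_repr x

end Subgeometry

/-! ### The Baer involution relating the Hermitian form and the quadric -/

section Configuration

variable {F V : Type*} [Field F] [CharP F 2] [AddCommGroup V] [Module F V] {k : ℕ}
  {h : V →ₗ[F] V →ₛₗ[iterateFrobenius F 2 k] F} {W : Submodule (subfieldGF F k) V}
  {Q : QuadraticForm F V} {Q₀ : QuadraticForm (subfieldGF F k) W}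

theorem form_smul_right (x y : V) (a : F) : h x (a • y) = a ^ 2 ^ k * h x y := by
  rw [map_smulₛₗ, iterateFrobenius_def, smul_eq_mul]

theorem form_smul_left (x y : V) (a : F) : h (a • x) y = a * h x y := by
  rw [map_smul, LinearMap.smul_apply, smul_eq_mul]

/-- A scalar that maps a nonzero vector of the subgeometry into it is in the subfield. -/
theorem IsSymplecticSubgeometry.mem_subfieldGF_of_smul_mem (hh : IsHermitianForm h)
    (hW : IsSymplecticSubgeometry h W) {x : V} (hx : x ∈ W) (hx0 : x ≠ 0) {a : F}
    (ha : a • x ∈ W) : a ∈ subfieldGF F k := by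
  obtain ⟨y, hy, hxy⟩ : ∃ y ∈ W, h x y ≠ 0 := by
    by_contra! hcon
    refine hx0 (hh.2 x fun y => ?_)
    have hy : y ∈ Submodule.span F (W : Set V) := hW.2.1 ▸ Submodule.mem_top
    induction hy using Submodule.span_induction with
    | mem y hy => exact hcon y hy
    | zero => exact map_zero _
    | add y z _ _ hy hz => rw [map_add, hy, hz, add_zero]
    | smul b y _ hy => rw [form_smul_right, hy, mul_zero]
  have h1 := hW.2.2.1 _ ha y hy
  rw [form_smul_left] at h1
  have h2 := (subfieldGF F k).div_mem h1 (hW.2.2.1 x hx y hy)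
  rwa [mul_div_cancel_right₀ _ hxy] at h2

theorem eq_smul_of_mem_quadric
    (hO : quadricPoints Q ∩ hermitianPoints h = subgeometryQuadricPoints W Q₀) {x : V}
    (hQx : Q x = 0) (hhx : h x x = 0) : ∃ w : W, Q₀ w = 0 ∧ ∃ a : F, x = a • (w : V) := by
  by_cases hx0 : x = 0
  · exact ⟨0, by simp, 0, by simp [hx0]⟩
  have hmem : Submodule.span F {x} ∈ quadricPoints Q ∩ hermitianPoints h := by
    refine ⟨⟨finrank_span_singleton hx0, fun y hy => ?_⟩,
      ⟨finrank_span_singleton hx0, fun y hy z hz => ?_⟩⟩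
    · obtain ⟨a, rfl⟩ := Submodule.mem_span_singleton.1 hy
      rw [map_smul_eq, hQx, mul_zero]
    · obtain ⟨a, rfl⟩ := Submodule.mem_span_singleton.1 hy
      obtain ⟨b, rfl⟩ := Submodule.mem_span_singleton.1 hz
      rw [form_smul_left, form_smul_right, hhx, mul_zero, mul_zero]
  rw [hO] at hmem
  obtain ⟨w, -, hw, hxw⟩ := hmem
  have h1 : x ∈ Submodule.span F {(w : V)} := hxw ▸ Submodule.mem_span_singleton_self x
  obtain ⟨a, ha⟩ := Submodule.mem_span_singleton.1 h1
  exact ⟨w, hw, a, ha.symm⟩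

theorem map_eq_zero_of_subgeometry
    (hO : quadricPoints Q ∩ hermitianPoints h = subgeometryQuadricPoints W Q₀) {w : W}
    (hw : Q₀ w = 0) : Q (w : V) = 0 := by
  by_cases hw0 : w = 0
  · simp [hw0]
  have hmem : Submodule.span F {(w : V)} ∈ quadricPoints Q ∩ hermitianPoints h := by
    rw [hO]; exact ⟨w, hw0, hw, rfl⟩
  exact hmem.1.2 _ (Submodule.mem_span_singleton_self _)

theorem subgeometry_map_eq_zero (hh : IsHermitianForm h) (hW : IsSymplecticSubgeometry h W)
    (hO : quadricPoints Q ∩ hermitianPoints h = subgeometryQuadricPoints W Q₀) {w : W}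
    (hw : Q (w : V) = 0) : Q₀ w = 0 := by
  by_cases hw0 : (w : V) = 0
  · rw [show w = 0 from Subtype.ext hw0, QuadraticMap.map_zero]
  obtain ⟨w', hw', a, ha⟩ := eq_smul_of_mem_quadric hO hw (hW.2.2.2 w w.2)
  have hw'0 : (w' : V) ≠ 0 := by
    intro h0
    rw [h0, smul_zero] at ha
    exact hw0 ha
  have ha' := hW.mem_subfieldGF_of_smul_mem hh w'.2 hw'0 (ha ▸ w.2)
  rw [show w = (⟨a, ha'⟩ : subfieldGF F k) • w' from Subtype.ext ha, map_smul_eq, hw', mul_zero]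

/-- The lines of the hyperbolic quadric are tangent to the Hermitian surface. -/
theorem form_eq_zero_of_polar_eq_zero (hk : 0 < k) (hF : Nat.card F = (2 ^ k) ^ 2)
    (hh : IsHermitianForm h) (hW : IsSymplecticSubgeometry h W) (hQ₀ : IsElliptic Q₀)
    (hO : quadricPoints Q ∩ hermitianPoints h = subgeometryQuadricPoints W Q₀) {w : W}
    (hw : Q₀ w = 0) {y : V} (hy : Q y = 0) (hwy : QuadraticMap.polar Q w y = 0) :
    h y w = 0 := by
  by_contra hyw
  obtain ⟨y₁, hy₁⟩ : ∃ y₁, y₁ = (h y w)⁻¹ • y := ⟨_, rfl⟩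
  have hy₁w : h y₁ w = 1 := by rw [hy₁, form_smul_left, inv_mul_cancel₀ hyw]
  have hwy₁ : h w y₁ = 1 := by rw [hh.1 y₁ w, hy₁w, one_pow]
  have hQy₁ : Q y₁ = 0 := by rw [hy₁, map_smul_eq, hy, mul_zero]
  have hpy₁ : QuadraticMap.polar Q w y₁ = 0 := by
    rw [hy₁, QuadraticMap.polar_smul_right, hwy, smul_zero]
  -- The line through `w` and `y₁` lies on the quadric. As `h y₁ w = 1`, this choice of `t` makes
  -- `y₁ + t • w` isotropic as well, hence a second point of the elliptic quadric on that line.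
  obtain ⟨t, ht⟩ := exists_add_pow_eq hk hF (hh.1 y₁ y₁).symm
  have hQw := map_eq_zero_of_subgeometry hO hw
  have hQ2 : Q (y₁ + t • (w : V)) = 0 := by
    rw [map_add_eq, map_smul_eq, hQw, hQy₁, QuadraticMap.polar_smul_right,
      QuadraticMap.polar_comm, hpy₁]
    simp
  have hh2 : h (y₁ + t • (w : V)) (y₁ + t • (w : V)) = 0 := by
    simp only [map_add, LinearMap.add_apply, form_smul_left, form_smul_right, hy₁w, hwy₁,
      hW.2.2.2 w w.2, ← ht]
    linear_combination (t + t ^ 2 ^ k) * CharTwo.two_eq_zero (R := F)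
  obtain ⟨w', hw', a, ha⟩ := eq_smul_of_mem_quadric hO hQ2 hh2
  have h1 : h (y₁ + t • (w : V)) w = 1 := by
    rw [map_add, LinearMap.add_apply, form_smul_left, hy₁w, hW.2.2.2 w w.2, mul_zero, add_zero]
  have hp1 : QuadraticMap.polar Q w (y₁ + t • (w : V)) = 0 := by
    rw [QuadraticMap.polar_add_right, QuadraticMap.polar_smul_right, polar_self_eq_zero, hpy₁]
    simp
  rw [ha, form_smul_left] at h1
  have ha0 : a ≠ 0 := left_ne_zero_of_mul_eq_one h1
  have hw'w : h w' w ≠ 0 := right_ne_zero_of_mul_eq_one h1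
  rw [ha, QuadraticMap.polar_smul_right, smul_eq_mul] at hp1
  have hp := (mul_eq_zero.1 hp1).resolve_left ha0
  -- Both vectors are isotropic while `h w' w ≠ 0`; so they span a line, which is totally singular
  -- for `Q₀` and contradicts ellipticity.
  have hli : LinearIndependent (subfieldGF F k) ![w, w'] := by
    rw [LinearIndependent.pair_iff]
    intro s t hst
    have hst' : (s : F) • (w : V) + (t : F) • (w' : V) = 0 := congrArg Subtype.val hst
    have e1 := congrArg (fun v => h v w) hst'
    have e2 := congrArg (fun v => h w' v) hst'
    simp only [map_add, LinearMap.add_apply, form_smul_left, form_smul_right, hW.2.2.2 w w.2,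
      hW.2.2.2 w' w'.2, mul_zero, zero_add, add_zero, map_zero, LinearMap.zero_apply] at e1 e2
    have e3 := (mul_eq_zero.1 e1).resolve_right hw'w
    have e4 := eq_zero_of_pow_eq_zero ((mul_eq_zero.1 e2).resolve_right hw'w)
    exact ⟨Subtype.ext e4, Subtype.ext e3⟩
  have hmem : Submodule.span (subfieldGF F k) (Set.range ![w, w']) ∈ quadricLines Q₀ := by
    refine ⟨by simpa using finrank_span_eq_card hli, fun x hx => ?_⟩
    simp only [Matrix.range_cons, Matrix.range_empty, Set.union_empty, Set.singleton_union] at hx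
    obtain ⟨s, t, rfl⟩ := Submodule.mem_span_pair.1 hx
    refine subgeometry_map_eq_zero hh hW hO ?_
    show Q ((s : F) • (w : V) + (t : F) • (w' : V)) = 0
    rw [map_add_eq, map_smul_eq, map_smul_eq, hQw, map_eq_zero_of_subgeometry hO hw',
      QuadraticMap.polar_smul_left, QuadraticMap.polar_smul_right, hp]
    simp
  rw [hQ₀.2.2] at hmem
  exact hmem

/-- On the elliptic quadric the polarities of the quadric and of the Hermitian surface agree. -/
theorem exists_form_eq_mul_polar (hk : 0 < k) (hF : Nat.card F = (2 ^ k) ^ 2)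
    (hh : IsHermitianForm h) (hW : IsSymplecticSubgeometry h W) (hQ : IsHyperbolic Q)
    (hQ₀ : IsElliptic Q₀)
    (hO : quadricPoints Q ∩ hermitianPoints h = subgeometryQuadricPoints W Q₀) {w : W}
    (hw : Q₀ w = 0) : ∃ c : F, ∀ x, h x w = c * QuadraticMap.polar Q x w := by
  have : Finite F := Nat.finite_of_card_ne_zero (by rw [hF]; positivity)
  by_cases hw0 : (w : V) = 0
  · exact ⟨0, fun x => by rw [hw0, map_zero, zero_mul]⟩
  have hQw := map_eq_zero_of_subgeometry hO hw
  -- Pairing with `w` by `h` and by the polar form both vanish on `b 0`, `b 2`, `b 3`, so the value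
  -- at `b 1` is the factor.
  obtain ⟨b, hb, h0, h2, h3⟩ := hQ.exists_isAdapted hQw hw0
  have hb2 : h (b 2) w = 0 :=
    form_eq_zero_of_polar_eq_zero hk hF hh hW hQ₀ hO hw h2 (by rw [← h0, hb.polar02])
  have hb3 : h (b 3) w = 0 :=
    form_eq_zero_of_polar_eq_zero hk hF hh hW hQ₀ hO hw h3 (by rw [← h0, hb.polar03])
  refine ⟨h (b 1) w, fun x => ?_⟩
  have hx := b.sum_repr x
  rw [Fin.sum_univ_four] at hx
  rw [← hx]
  simp only [map_add, LinearMap.add_apply, form_smul_left, QuadraticMap.polar_add_left,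
    QuadraticMap.polar_smul_left, hb2, hb3]
  rw [← h0, QuadraticMap.polar_comm Q (b 1), QuadraticMap.polar_comm Q (b 2),
    QuadraticMap.polar_comm Q (b 3), hb.polar01, hb.polar02, hb.polar03, polar_self_eq_zero, h0,
    hW.2.2.2 w w.2]
  simp [mul_comm]

/-- The factor found at each singular `w` is independent of `w`, by `IsAdapted.exists_eq_smul`
applied to the maps sending `w` to its functionals under the two forms. -/
theorem exists_form_eq_mul_polar_subgeometry (hk : 0 < k) (hF : Nat.card F = (2 ^ k) ^ 2)
    (hh : IsHermitianForm h) (hW : IsSymplecticSubgeometry h W) (hQ : IsHyperbolic Q)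
    (hQ₀ : IsElliptic Q₀)
    (hO : quadricPoints Q ∩ hermitianPoints h = subgeometryQuadricPoints W Q₀) :
    ∃ c : F, c ≠ 0 ∧ ∀ w : W, ∀ x, h x w = c * QuadraticMap.polar Q x w := by
  have : Finite F := Nat.finite_of_card_ne_zero (by rw [hF]; positivity)
  obtain ⟨b, hb⟩ := hQ₀.2.1.exists_adapted_basis hQ₀.1
  obtain ⟨b', hb'⟩ := exists_basis_coe hQ.1 hW.2.1 b
  let f : W →ₗ[subfieldGF F k] (V → F) :=
    { toFun := fun w x => h x w
      map_add' := fun w w' => by ext x; simp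
      map_smul' := fun a w => by
        ext x
        show h x ((a : F) • (w : V)) = (a : F) * h x w
        rw [form_smul_right, mem_subfieldGF.1 a.2] }
  let i : W →ₗ[subfieldGF F k] (V → F) :=
    { toFun := fun w x => QuadraticMap.polar Q x w
      map_add' := fun w w' => by ext x; simp [QuadraticMap.polar_add_right]
      map_smul' := fun a w => by
        ext x
        show QuadraticMap.polar Q x ((a : F) • (w : V)) = (a : F) * QuadraticMap.polar Q x w
        rw [QuadraticMap.polar_smul_right, smul_eq_mul] }
  have hi : LinearIndependent F fun j => i (b j) := by
    rw [Fintype.linearIndependent_iff]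
    intro g hg
    refine Fintype.linearIndependent_iff.1 b'.linearIndependent g ?_
    refine hQ.2.1.polar_nondegenerate hQ.1 fun x => ?_
    have h1 := congrFun hg x
    rw [Fin.sum_univ_four] at h1 ⊢
    rw [QuadraticMap.polar_comm]
    simp only [QuadraticMap.polar_add_right, QuadraticMap.polar_smul_right, hb']
    exact h1
  obtain ⟨c, hc⟩ := hb.exists_eq_smul (F := F) (f := f) hi fun w hw => by
    obtain ⟨c, hc⟩ := exists_form_eq_mul_polar hk hF hh hW hQ hQ₀ hO hw
    exact ⟨c, funext hc⟩
  have hc' : ∀ w : W, ∀ x, h x w = c * QuadraticMap.polar Q x w := fun w x => congrFun (hc w) x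
  refine ⟨c, ?_, hc'⟩
  rintro rfl
  refine b'.ne_zero 0 (hh.2 _ fun y => ?_)
  rw [← b'.sum_repr y, map_sum]
  refine Finset.sum_eq_zero fun j _ => ?_
  rw [form_smul_right, hb' j, hc', zero_mul, mul_zero]

/-- `τ` is the Baer involution of the subgeometry `W`, and it transforms the polar form of `Q`
into the Hermitian form `h`. -/
structure IsBaerInvolution (h : V →ₗ[F] V →ₛₗ[iterateFrobenius F 2 k] F)
    (W : Submodule (subfieldGF F k) V) (Q : QuadraticForm F V) (τ : V →+ V) : Prop where
  smul : ∀ (a : F) (x : V), τ (a • x) = a ^ 2 ^ k • τ x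
  involutive : ∀ x, τ (τ x) = x
  fixed : ∀ x, τ x = x ↔ x ∈ W
  form : ∀ x y, h x y = QuadraticMap.polar Q x (τ y)
  map : ∀ x, Q (τ x) = Q x ^ 2 ^ k

theorem map_add_pow (a : F) (b : F) : (a + b) ^ 2 ^ k = a ^ 2 ^ k + b ^ 2 ^ k :=
  add_pow_char_pow ..

/-- After rescaling the quadratic form, there is a Baer involution relating the three forms. -/
theorem exists_isBaerInvolution (hk : 0 < k) (hF : Nat.card F = (2 ^ k) ^ 2)
    (hh : IsHermitianForm h) (hW : IsSymplecticSubgeometry h W) (hQ : IsHyperbolic Q)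
    (hQ₀ : IsElliptic Q₀)
    (hO : quadricPoints Q ∩ hermitianPoints h = subgeometryQuadricPoints W Q₀) :
    ∃ (c : F) (τ : V →+ V), c ≠ 0 ∧ IsBaerInvolution h W (c • Q) τ := by
  have : Finite F := Nat.finite_of_card_ne_zero (by rw [hF]; positivity)
  obtain ⟨c, hc0, hc⟩ := exists_form_eq_mul_polar_subgeometry hk hF hh hW hQ hQ₀ hO
  obtain ⟨τ, hτs, hτi, hτf⟩ := exists_baer_involution hF hQ.1 hW.1 hW.2.1
  have hpol : ∀ x y, QuadraticMap.polar (c • Q) x y = c * QuadraticMap.polar Q x y := by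
    intro x y
    simp only [QuadraticMap.polar, _root_.smul_apply, smul_eq_mul]
    ring
  have hform : ∀ x y, h x y = QuadraticMap.polar (c • Q) x (τ y) := by
    -- Both sides are semilinear in the second variable and agree on `W`, which spans and is fixed
    -- by `τ`.
    intro x
    refine semilinear_ext hW.2.1 (φ := fun a => a ^ 2 ^ k) (f := (h x).toAddMonoidHom)
      (g := ((QuadraticMap.polarBilin (c • Q) x).toAddMonoidHom).comp τ)
      (fun a y => form_smul_right x y a) (fun a y => ?_) fun w hw => ?_
    · show QuadraticMap.polar (c • Q) x (τ (a • y)) = _ • QuadraticMap.polar (c • Q) x (τ y)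
      rw [hτs, QuadraticMap.polar_smul_right]
    · show h x w = QuadraticMap.polar (c • Q) x (τ w)
      rw [(hτf w).2 hw, hpol]
      exact hc ⟨w, hw⟩ x
  have hpolτ : ∀ x y, QuadraticMap.polar (c • Q) (τ x) (τ y) =
      QuadraticMap.polar (c • Q) x y ^ 2 ^ k := by
    intro x y
    rw [← hform, hh.1, hform, hτi, QuadraticMap.polar_comm]
  -- `D` measures the failure of `map`. By `hpolτ` its two terms have the same polar form, so it is
  -- additive; it then suffices that it vanish on a basis.
  let D : V →+ F :=
    { toFun := fun x => (c • Q) (τ x) + (c • Q) x ^ 2 ^ k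
      map_zero' := by simp
      map_add' := fun x y => by
        rw [map_add τ, map_add_eq, map_add_eq (c • Q) x y, hpolτ, map_add_pow, map_add_pow]
        linear_combination (QuadraticMap.polar (c • Q) x y ^ 2 ^ k) * CharTwo.two_eq_zero (R := F) }
  have hDs : ∀ (a : F) (x : V), D (a • x) = (a ^ 2 ^ k) ^ 2 • D x := by
    intro a x
    show (c • Q) (τ (a • x)) + (c • Q) (a • x) ^ 2 ^ k = _ * ((c • Q) (τ x) + (c • Q) x ^ 2 ^ k)
    rw [hτs, map_smul_eq, map_smul_eq]
    ring
  obtain ⟨b, hb⟩ := hQ₀.2.1.exists_adapted_basis hQ₀.1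
  have hD0 : ∀ w : W, Q₀ w = 0 → D w = 0 := by
    intro w hw
    show (c • Q) (τ w) + (c • Q) (w : V) ^ 2 ^ k = 0
    rw [(hτf w).2 w.2, _root_.smul_apply, map_eq_zero_of_subgeometry hO hw]
    simp
  obtain ⟨b', hb'⟩ := exists_basis_coe hQ.1 hW.2.1 b
  -- `D` vanishes at `b 0`, at `b 1` and at the singular vector `b 0 + z + Q₀ z • b 1`, hence at
  -- `z`.
  have hDz : ∀ z, QuadraticMap.polar Q₀ (b 0) z = 0 → QuadraticMap.polar Q₀ (b 1) z = 0 →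
      D z = 0 := by
    intro z h0 h1
    have h2 := hD0 (b 0 + z + Q₀ z • b 1) (by
      rw [map_add_eq, map_add_eq, map_smul_eq, hb.map_zero, hb.map_one, h0,
        QuadraticMap.polar_smul_right, QuadraticMap.polar_add_left, hb.polar01,
        QuadraticMap.polar_comm Q₀ z, h1]
      simp [CharTwo.add_self_eq_zero])
    have h3 : ((b 0 + z + Q₀ z • b 1 : W) : V) = (b 0 : V) + z + (Q₀ z : F) • (b 1 : V) := rfl
    rw [h3, map_add, map_add, hDs, hD0 _ hb.map_zero, hD0 _ hb.map_one] at h2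
    simpa using h2
  have hDb : ∀ j, D (b' j) = 0 := by
    intro j
    rw [hb']
    fin_cases j
    exacts [hD0 _ hb.map_zero, hD0 _ hb.map_one, hDz _ hb.polar02 hb.polar12,
      hDz _ hb.polar03 hb.polar13]
  refine ⟨c, τ, hc0, hτs, hτi, hτf, hform, fun x => ?_⟩
  have hDx : D x = 0 := by
    rw [← b'.sum_repr x, map_sum]
    exact Finset.sum_eq_zero fun j _ => by rw [hDs, hDb, smul_zero]
  exact CharTwo.add_eq_zero.1 hDx

end Configuration

/-! ### Collineations and rescaling of quadrics -/

section Collineation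

variable {F V : Type*} [Field F] [AddCommGroup V] [Module F V]

theorem finrank_eq_of_equiv [Finite F] [FiniteDimensional F V] (f : V ≃ V) {L M : Submodule F V}
    (h : ∀ x, f x ∈ M ↔ x ∈ L) : finrank F M = finrank F L := by
  have h1 : Nat.card L = Nat.card M := Nat.card_congr (f.subtypeEquiv fun x => (h x).symm)
  rw [Module.natCard_eq_pow_finrank (K := F) (V := L),
    Module.natCard_eq_pow_finrank (K := F) (V := M)] at h1
  exact (Nat.pow_right_injective Finite.one_lt_card h1).symm

theorem IsHyperbolic.smul {Q : QuadraticForm F V} (hQ : IsHyperbolic Q) {c : F} (hc : c ≠ 0) :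
    IsHyperbolic (c • Q) := by
  refine ⟨hQ.1, fun x hx h => hQ.2.1 x ?_ fun y => ?_, ?_⟩
  · exact (mul_eq_zero.1 hx).resolve_left hc
  · have h1 := h y
    have h2 : QuadraticMap.polar (c • Q) x y = c * QuadraticMap.polar Q x y := by
      simp only [QuadraticMap.polar, _root_.smul_apply, smul_eq_mul]
      ring
    rw [h2] at h1
    exact (mul_eq_zero.1 h1).resolve_left hc
  · obtain ⟨L, hL2, hL⟩ := hQ.2.2
    exact ⟨L, hL2, fun x hx => by rw [_root_.smul_apply, hL x hx, smul_zero]⟩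

theorem quadricPoints_smul (Q : QuadraticForm F V) {c : F} (hc : c ≠ 0) :
    quadricPoints (c • Q) = quadricPoints Q := by
  simp [quadricPoints, hc]

theorem reguli_smul (Q : QuadraticForm F V) {c : F} (hc : c ≠ 0) :
    reguli (c • Q) = reguli Q := by
  have h : quadricLines (c • Q) = quadricLines Q := by simp [quadricLines, hc]
  simp only [reguli, regulusOf, h]

theorem smul_span_eq_zero {g : Submodule F V ≃o Submodule F V} {T : V → V}
    (hT : ∀ (S : Submodule F V) (x : V), T x ∈ g S ↔ x ∈ S) {Q : QuadraticForm F V}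
    (hg : g • quadricPoints Q = quadricPoints Q) {x : V} (hx : Q x = 0) (hx0 : x ≠ 0) :
    Q (T x) = 0 := by
  have h1 : Submodule.span F {x} ∈ quadricPoints Q := by
    refine ⟨finrank_span_singleton hx0, fun y hy => ?_⟩
    obtain ⟨a, rfl⟩ := Submodule.mem_span_singleton.1 hy
    rw [map_smul_eq, hx, mul_zero]
  have h2 := Set.smul_mem_smul_set (a := g) h1
  rw [hg] at h2
  exact h2.2 _ ((hT _ _).2 (Submodule.mem_span_singleton_self x))

end Collineation

/-! ### The stabiliser of the quadric and its action on external lines -/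

section Stabilizer

variable {F V : Type*} [Field F] [CharP F 2] [AddCommGroup V] [Module F V] {k : ℕ}
  {h : V →ₗ[F] V →ₛₗ[iterateFrobenius F 2 k] F} {W : Submodule (subfieldGF F k) V}
  {Q : QuadraticForm F V} {Q₀ : QuadraticForm (subfieldGF F k) W} {τ : V →+ V}

theorem hermitian_map_eq_zero {g : Submodule F V ≃o Submodule F V} {T : V → V}
    (hT : ∀ (S : Submodule F V) (x : V), T x ∈ g S ↔ x ∈ S)
    (hg : g • hermitianPoints h = hermitianPoints h) {x : V} (hx : h x x = 0) (hx0 : x ≠ 0) :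
    h (T x) (T x) = 0 := by
  have h1 : Submodule.span F {x} ∈ hermitianPoints h := by
    refine ⟨finrank_span_singleton hx0, fun y hy z hz => ?_⟩
    obtain ⟨a, rfl⟩ := Submodule.mem_span_singleton.1 hy
    obtain ⟨b, rfl⟩ := Submodule.mem_span_singleton.1 hz
    rw [form_smul_left, form_smul_right, hx, mul_zero, mul_zero]
  have h2 := Set.smul_mem_smul_set (a := g) h1
  rw [hg] at h2
  have h3 := (hT _ _).2 (Submodule.mem_span_singleton_self x)
  exact h2.2 _ h3 _ h3

/-- A semilinear bijection that preserves a hyperbolic quadric is a similitude. -/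
theorem IsHyperbolic.exists_semisimilitude [Finite F] (hQ : IsHyperbolic Q) {σ : F ≃+* F}
    {T : V ≃+ V} (hTs : ∀ (a : F) (x : V), T (a • x) = σ a • T x)
    (hTQ : ∀ x, Q x = 0 → Q (T x) = 0) : ∃ c : F, c ≠ 0 ∧ ∀ x, Q (T x) = c * σ (Q x) := by
  have hpol : ∀ x y, QuadraticMap.polar (fun x => σ.symm (Q (T x))) x y =
      σ.symm (QuadraticMap.polar Q (T x) (T y)) := by
    intro x y
    simp [QuadraticMap.polar]
  -- Untwisting by `σ` makes `Q ∘ T` a genuine quadratic form that vanishes on the quadric, so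
  -- `exists_eq_mul` applies.
  let Q' : QuadraticForm F V := QuadraticMap.ofPolar (fun x => σ.symm (Q (T x)))
    (fun a x => by
      rw [hTs, map_smul_eq, map_mul, map_pow, σ.symm_apply_apply, sq, smul_eq_mul])
    (fun x x' y => by
      rw [hpol, hpol, hpol, map_add T, QuadraticMap.polar_add_left, map_add])
    (fun a x y => by
      rw [hpol, hpol, hTs, QuadraticMap.polar_smul_left, smul_eq_mul, map_mul, σ.symm_apply_apply,
        smul_eq_mul])
  obtain ⟨c, hc⟩ := hQ.exists_eq_mul (Q' := Q') fun x hx => by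
    show σ.symm (Q (T x)) = 0
    rw [hTQ x hx, map_zero]
  have hc' : ∀ x, Q (T x) = σ c * σ (Q x) := by
    intro x
    have h1 : σ.symm (Q (T x)) = c * Q x := hc x
    rw [← map_mul, ← h1, σ.apply_symm_apply]
  refine ⟨σ c, ?_, hc'⟩
  intro h0
  obtain ⟨b, hb⟩ := hQ.2.1.exists_adapted_basis hQ.1
  have hz : ∀ x, Q x = 0 := by
    intro x
    obtain ⟨y, rfl⟩ := T.surjective x
    rw [hc', h0, zero_mul]
  have := hb.polar01
  simp [QuadraticMap.polar, hz] at this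

/-- The elements of the stabiliser of the quadric are induced by semilinear similitudes that
commute with the Baer involution. -/
theorem exists_commuting_semisimilitude (hF : Nat.card F = (2 ^ k) ^ 2)
    (hW : IsSymplecticSubgeometry h W) (hQ : IsHyperbolic Q)
    (hQ₀ : IsElliptic Q₀)
    (hO : quadricPoints Q ∩ hermitianPoints h = subgeometryQuadricPoints W Q₀)
    (hτ : IsBaerInvolution h W Q τ) {g : Submodule F V ≃o Submodule F V}
    (hg : g ∈ quadricStabilizer h Q) :
    ∃ (σ : F ≃+* F) (T : V ≃+ V) (c : F), (∀ (a : F) (x : V), T (a • x) = σ a • T x) ∧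
      (∀ (S : Submodule F V) (x : V), T x ∈ g S ↔ x ∈ S) ∧ (∀ x, τ (T x) = T (τ x)) ∧
      ∀ x, Q (T x) = c * σ (Q x) := by
  have : Finite F := Nat.finite_of_card_ne_zero (by rw [hF]; positivity)
  obtain ⟨⟨⟨σ, T₀, hT₀s, hT₀⟩, hgH⟩, hgQ⟩ := hg
  obtain ⟨b, hb⟩ := hQ₀.2.1.exists_adapted_basis hQ₀.1
  obtain ⟨b', hb'⟩ := exists_basis_coe hQ.1 hW.2.1 b
  have he0 : (b 0 : V) ≠ 0 := hb' 0 ▸ b'.ne_zero 0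
  have hsing : ∀ (T : V ≃+ V), (∀ (S : Submodule F V) (x : V), T x ∈ g S ↔ x ∈ S) →
      ∀ w : W, Q₀ w = 0 → ∃ w' : W, ∃ a : F, T w = a • (w' : V) := by
    intro T hT w hw
    by_cases hw0 : (w : V) = 0
    · exact ⟨0, 0, by simp [hw0]⟩
    obtain ⟨w', -, a, ha⟩ := eq_smul_of_mem_quadric hO
      (smul_span_eq_zero hT hgQ (map_eq_zero_of_subgeometry hO hw) hw0)
      (hermitian_map_eq_zero hT hgH (hW.2.2.2 w w.2) hw0)
    exact ⟨w', a, ha⟩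
  obtain ⟨w₀, a₀, ha₀⟩ := hsing T₀ hT₀ _ hb.map_zero
  have ha₀0 : a₀ ≠ 0 := by
    rintro rfl
    rw [zero_smul] at ha₀
    exact he0 (T₀.injective (ha₀.trans (map_zero T₀).symm))
  -- The inducing map is only determined up to a scalar; this one sends `b 0` into `W`, which will
  -- normalise the factor `d` to 1.
  let T : V ≃+ V := T₀.trans (LinearEquiv.smulOfNeZero F V a₀⁻¹ (inv_ne_zero ha₀0)).toAddEquiv
  have hTT₀ : ∀ x, T x = a₀⁻¹ • T₀ x := fun x => rfl
  have hTs : ∀ (a : F) (x : V), T (a • x) = σ a • T x := by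
    intro a x
    rw [hTT₀, hTT₀, hT₀s, smul_comm]
  have hT : ∀ (S : Submodule F V) (x : V), T x ∈ g S ↔ x ∈ S := by
    intro S x
    rw [hTT₀, (g S).smul_mem_iff (inv_ne_zero ha₀0), hT₀]
  have hTe : T (b 0) = w₀ := by rw [hTT₀, ha₀, inv_smul_smul₀ ha₀0]
  have hTQ : ∀ x, Q x = 0 → Q (T x) = 0 := by
    intro x hx
    by_cases hx0 : x = 0
    · simp [hx0]
    · exact smul_span_eq_zero hT hgQ hx hx0
  obtain ⟨c, -, hc⟩ := hQ.exists_semisimilitude hTs hTQ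
  have hTsymm : ∀ (a : F) (x : V), T.symm (σ a • x) = a • T.symm x := by
    intro a x
    rw [AddEquiv.symm_apply_eq, hTs, AddEquiv.apply_symm_apply]
  -- `T⁻¹ τ T` multiplies each singular vector of `W` by a scalar, because `T` maps it to a multiple
  -- of a vector of `W`. Hence it is one scalar on `W`, and `b 0` shows that the scalar is 1.
  let f : W →ₗ[subfieldGF F k] V :=
    { toFun := fun w => T.symm (τ (T w))
      map_add' := fun w w' => by simp
      map_smul' := fun a w => by
        show T.symm (τ (T ((a : F) • (w : V)))) = (a : F) • T.symm (τ (T w))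
        rw [hTs, hτ.smul, ← map_pow, mem_subfieldGF.1 a.2, hTsymm] }
  have hi : LinearIndependent F fun j => W.subtype (b j) := by
    have : (fun j => W.subtype (b j)) = b' := funext fun j => (hb' j).symm
    rw [this]
    exact b'.linearIndependent
  obtain ⟨d, hd⟩ := hb.exists_eq_smul (F := F) (f := f) hi fun w hw => by
    obtain ⟨w', a, ha⟩ := hsing T hT w hw
    have hw' := (hτ.fixed w').2 w'.2
    by_cases ha0 : a = 0
    · refine ⟨0, ?_⟩
      show T.symm (τ (T w)) = _
      rw [ha, ha0]
      simp
    · refine ⟨σ.symm (a ^ 2 ^ k / a), ?_⟩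
      show T.symm (τ (T w)) = σ.symm (a ^ 2 ^ k / a) • (w : V)
      rw [AddEquiv.symm_apply_eq, hTs, σ.apply_symm_apply, ha, hτ.smul, hw', smul_smul,
        div_mul_cancel₀ _ ha0]
  have hd1 : d = 1 := by
    have h1 : T.symm (τ (T (b 0))) = d • (b 0 : V) := hd (b 0)
    rw [hTe, (hτ.fixed w₀).2 w₀.2, ← hTe, AddEquiv.symm_apply_apply] at h1
    have h2 : (1 - d) • (b 0 : V) = 0 := by rw [sub_smul, one_smul, ← h1, sub_self]
    exact (sub_eq_zero.1 ((smul_eq_zero.1 h2).resolve_right he0)).symm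
  refine ⟨σ, T, c, hTs, hT, ?_, hc⟩
  refine semilinear_ext hW.2.1 (φ := fun a => σ a ^ 2 ^ k) (f := τ.comp T.toAddMonoidHom)
    (g := T.toAddMonoidHom.comp τ) (fun a x => ?_) (fun a x => ?_) fun w hw => ?_
  · show τ (T (a • x)) = _ • τ (T x)
    rw [hTs, hτ.smul]
  · show T (τ (a • x)) = _ • T (τ x)
    rw [hτ.smul, hTs, map_pow]
  · show τ (T w) = T (τ w)
    have h1 : T.symm (τ (T w)) = d • w := hd ⟨w, hw⟩
    rw [(hτ.fixed w).2 hw, ← AddEquiv.symm_apply_eq, h1, hd1, one_smul]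

theorem smul_mem_quadricLines [Finite F] (hQ : IsHyperbolic Q)
    {g : Submodule F V ≃o Submodule F V} (hg : g ∈ quadricStabilizer h Q) {L : Submodule F V}
    (hL : L ∈ quadricLines Q) : g • L ∈ quadricLines Q := by
  have : FiniteDimensional F V := FiniteDimensional.of_finrank_pos (by rw [hQ.1]; norm_num)
  obtain ⟨⟨⟨σ, T, hTs, hT⟩, -⟩, hgQ⟩ := hg
  refine ⟨(finrank_eq_of_equiv T.toEquiv fun x => hT L x).trans hL.1, fun x hx => ?_⟩
  obtain ⟨x, rfl⟩ := T.surjective x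
  by_cases hx0 : x = 0
  · simp [hx0]
  · exact smul_span_eq_zero hT hgQ (hL.2 x ((hT L x).1 hx)) hx0

theorem smul_regulusOf [Finite F] (hQ : IsHyperbolic Q)
    {g : Submodule F V ≃o Submodule F V} (hg : g ∈ quadricStabilizer h Q) (L : Submodule F V) :
    g • regulusOf Q L = regulusOf Q (g • L) := by
  ext N
  rw [Set.mem_smul_set_iff_inv_smul_mem]
  have h1 : g⁻¹ • N ∈ quadricLines Q ↔ N ∈ quadricLines Q :=
    ⟨fun h => by simpa using smul_mem_quadricLines hQ hg h,
      fun h => smul_mem_quadricLines hQ (inv_mem hg) h⟩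
  have h2 : Disjoint (g⁻¹ • N) L ↔ Disjoint N (g • L) := by
    have := disjoint_map_orderIso_iff (f := g) (a := g⁻¹ • N) (b := L)
    rw [← this]
    have e : g (g⁻¹ • N) = N := g.apply_symm_apply N
    rw [e]
    rfl
  exact and_congr h1 (or_congr inv_smul_eq_iff h2)

theorem smul_mem_reguli [Finite F] (hQ : IsHyperbolic Q)
    {g : Submodule F V ≃o Submodule F V} (hg : g ∈ quadricStabilizer h Q)
    {R : Set (Submodule F V)} (hR : R ∈ reguli Q) : g • R ∈ reguli Q := by
  obtain ⟨L, hL, rfl⟩ := hR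
  exact ⟨g • L, smul_mem_quadricLines hQ hg hL, smul_regulusOf hQ hg L⟩

theorem mem_regulusStabilizer {g : Submodule F V ≃o Submodule F V} :
    g ∈ regulusStabilizer h Q ↔ g ∈ quadricStabilizer h Q ∧ ∀ R ∈ reguli Q, g • R = R := by
  simp [regulusStabilizer, Subgroup.mem_inf, Subgroup.mem_iInf, MulAction.mem_stabilizer_iff]

/-- The stabiliser of the quadric permutes the reguli, so fixing all of them is a property stable
under conjugation. -/
theorem conj_mem_regulusStabilizer [Finite F] (hQ : IsHyperbolic Q)
    {g n : Submodule F V ≃o Submodule F V} (hg : g ∈ quadricStabilizer h Q)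
    (hn : n ∈ regulusStabilizer h Q) : g * n * g⁻¹ ∈ regulusStabilizer h Q := by
  rw [mem_regulusStabilizer] at hn ⊢
  refine ⟨mul_mem (mul_mem hg hn.1) (inv_mem hg), fun R hR => ?_⟩
  rw [mul_smul, mul_smul, hn.2 _ (smul_mem_reguli hQ (inv_mem hg) hR), smul_inv_smul]

/-- A similitude commuting with `τ` preserves `W`, the fixed set of `τ`, and preserves `h` up to a
scalar and a field automorphism, since `h` is built from `Q` and `τ`. -/
theorem smul_mem_externalLines (hF : Nat.card F = (2 ^ k) ^ 2)
    (hW : IsSymplecticSubgeometry h W) (hQ : IsHyperbolic Q) (hQ₀ : IsElliptic Q₀)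
    (hO : quadricPoints Q ∩ hermitianPoints h = subgeometryQuadricPoints W Q₀)
    (hτ : IsBaerInvolution h W Q τ) {g : Submodule F V ≃o Submodule F V}
    (hg : g ∈ quadricStabilizer h Q) {L : Submodule F V} (hL : L ∈ externalLines h W) :
    g • L ∈ externalLines h W := by
  have : Finite F := Nat.finite_of_card_ne_zero (by rw [hF]; positivity)
  have : FiniteDimensional F V := FiniteDimensional.of_finrank_pos (by rw [hQ.1]; norm_num)
  obtain ⟨σ, T, c, hTs, hT, hTτ, hc⟩ := exists_commuting_semisimilitude hF hW hQ hQ₀ hO hτ hg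
  refine ⟨⟨(finrank_eq_of_equiv T.toEquiv fun x => hT L x).trans hL.1.1, fun x hx y hy => ?_⟩,
    fun x hxW hx => ?_⟩
  · obtain ⟨x, rfl⟩ := T.surjective x
    obtain ⟨y, rfl⟩ := T.surjective y
    rw [hτ.form, hTτ, polar_semisimilitude (σ := (σ : F →+* F)) (map_add T) hc, ← hτ.form,
      hL.1.2 x ((hT L x).1 hx) y ((hT L y).1 hy), map_zero, mul_zero]
  · obtain ⟨x, rfl⟩ := T.surjective x
    have h1 : τ x = x := T.injective (by rw [← hTτ, (hτ.fixed _).2 hxW])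
    rw [hL.2 x ((hτ.fixed x).1 h1) ((hT L x).1 hx), map_zero]

/-- A collineation that stabilises the quadric and an external line maps each line of the quadric
to itself or to a line skew to it. -/
theorem smul_eq_or_disjoint (hF : Nat.card F = (2 ^ k) ^ 2)
    (hW : IsSymplecticSubgeometry h W) (hQ : IsHyperbolic Q) (hQ₀ : IsElliptic Q₀)
    (hO : quadricPoints Q ∩ hermitianPoints h = subgeometryQuadricPoints W Q₀)
    (hτ : IsBaerInvolution h W Q τ) {g : Submodule F V ≃o Submodule F V}
    (hg : g ∈ quadricStabilizer h Q) {L : Submodule F V} (hL : L ∈ externalLines h W)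
    (hgL : g • L = L) {M : Submodule F V} (hM : M ∈ quadricLines Q) :
    g • M = M ∨ Disjoint (g • M) M := by
  have : Finite F := Nat.finite_of_card_ne_zero (by rw [hF]; positivity)
  have : FiniteDimensional F V := FiniteDimensional.of_finrank_pos (by rw [hQ.1]; norm_num)
  have : Finite V := Module.finite_of_finite F
  obtain ⟨σ, T, c, hTs, hT, hTτ, hc⟩ := exists_commuting_semisimilitude hF hW hQ hQ₀ hO hτ hg
  have hgM := smul_mem_quadricLines hQ hg hM
  have hTL : ∀ x, T x ∈ L ↔ x ∈ L := by
    intro x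
    have := hT L x
    rwa [show g L = L from hgL] at this
  -- A singular vector of `L` is also isotropic, so it is a multiple of a vector of `W`, and `L` is
  -- external.
  have haniso : ∀ x ∈ L, Q x = 0 → x = 0 := by
    intro x hx hQx
    obtain ⟨w, -, a, ha⟩ := eq_smul_of_mem_quadric hO hQx (hL.1.2 x hx x hx)
    by_cases ha0 : a = 0
    · rw [ha, ha0, zero_smul]
    · have hw : (w : V) ∈ L := by
        rw [ha] at hx
        exact (L.smul_mem_iff ha0).1 hx
      rw [ha, hL.2 w w.2 hw, smul_zero]
  let q : QuadraticForm F L := Q.comp L.subtype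
  have hqQ : ∀ x : L, q x = Q x := fun x => rfl
  have hq : ∀ x, q x = 0 → x = 0 := fun x hx => Subtype.ext (haniso x x.2 hx)
  -- This is `τ L`, written as a preimage. It complements both `M` and `L`.
  let L' : Submodule F V :=
    { carrier := {z | τ z ∈ L}
      add_mem' := fun {x y} hx hy => by
        show τ (x + y) ∈ L
        rw [map_add]; exact L.add_mem hx hy
      zero_mem' := by
        show τ 0 ∈ L
        rw [map_zero]; exact L.zero_mem
      smul_mem' := fun a x hx => by
        show τ (a • x) ∈ L
        rw [hτ.smul]; exact L.smul_mem _ hx }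
  have hL' : ∀ z, z ∈ L' ↔ τ z ∈ L := fun z => Iff.rfl
  have hL'2 : finrank F L' = 2 := by
    rw [← hL.1.1]
    exact finrank_eq_of_equiv ⟨τ, τ, hτ.involutive, hτ.involutive⟩ fun x => by
      rw [hL']
      show τ (τ x) ∈ L ↔ _
      rw [hτ.involutive]
  have hdecomp : ∀ A : Submodule F V, finrank F A = 2 → (∀ x ∈ A, τ x ∈ L → x = 0) →
      ∀ x, ∃ a ∈ A, ∃ y : L, x = a + τ y := by
    intro A hA hAL x
    have h1 : A ⊔ L' = ⊤ := Submodule.eq_top_of_disjoint A L' (by rw [hQ.1, hA, hL'2])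
      (Submodule.disjoint_def.2 hAL)
    obtain ⟨a, ha, z, hz, rfl⟩ := Submodule.mem_sup.1 (h1 ▸ Submodule.mem_top : x ∈ A ⊔ L')
    exact ⟨a, ha, ⟨τ z, hz⟩, by rw [hτ.involutive]⟩
  have hML : ∀ x ∈ M, τ x ∈ L → x = 0 := by
    intro x hx hxL
    have h1 := haniso _ hxL (by rw [hτ.map, hM.2 x hx, zero_pow (by positivity)])
    rw [← hτ.involutive x, h1, map_zero]
  -- `L` is orthogonal to `τ L`, so a common vector lies in the radical of the anisotropic form on
  -- `L`.
  have hLL : ∀ x ∈ L, τ x ∈ L → x = 0 := by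
    intro x hx hxL
    have h1 : (⟨x, hx⟩ : L) = 0 := polar_injective hq hL.1.1 fun y => by
      show QuadraticMap.polar Q x y = 0
      rw [QuadraticMap.polar_comm, ← hτ.involutive x, ← hτ.form]
      exact hL.1.2 y y.2 _ hxL
    exact congrArg Subtype.val h1
  -- `M` is the graph of a map `L → τ L`; composing with `τ` gives `s : L → L`.
  have hex : ∀ x : L, ∃ y : L, (x : V) + τ y ∈ M := by
    intro x
    obtain ⟨m, hm, y, hy⟩ := hdecomp M hM.1 hML x
    refine ⟨-y, ?_⟩
    rw [hy]
    simpa using hm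
  choose s hs using hex
  have huniq : ∀ x y : L, (x : V) + τ y ∈ M → y = s x := by
    intro x y hy
    have h1 : τ ((y : V) - s x) ∈ M := by
      have := M.sub_mem hy (hs x)
      rwa [add_sub_add_left_eq_sub, ← map_sub] at this
    have h2 := hML _ h1 (by rw [hτ.involutive]; exact (y - s x).2)
    have h3 : (y : V) - s x = 0 := by rw [← hτ.involutive ((y : V) - s x), h2, map_zero]
    exact Subtype.ext (sub_eq_zero.1 h3)
  have hsadd : ∀ x y, s (x + y) = s x + s y := by
    intro x y
    refine (huniq _ _ ?_).symm
    have := M.add_mem (hs x) (hs y)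
    rw [add_add_add_comm, ← map_add] at this
    exact this
  have hssmul : ∀ (a : F) (x : L), s (a • x) = a ^ 2 ^ k • s x := by
    intro a x
    refine (huniq _ _ ?_).symm
    have := M.smul_mem a (hs x)
    rw [smul_add] at this
    show a • (x : V) + τ (a ^ 2 ^ k • (s x : V)) ∈ M
    rwa [hτ.smul, pow_pow_eq hF]
  -- Singularity of `x + τ (s x)`, whose two summands are orthogonal, gives `q x = q (s x) ^ 2 ^ k`.
  have hsq : ∀ x, q (s x) = q x ^ 2 ^ k := by
    intro x
    have h1 := hM.2 _ (hs x)
    rw [map_add_eq, hτ.map, ← hτ.form, hL.1.2 x x.2 _ (s x).2, add_zero,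
      CharTwo.add_eq_zero] at h1
    rw [hqQ, hqQ, h1, pow_pow_eq hF]
  let sHom : L →+ L := AddMonoidHom.mk' s hsadd
  have hsinj : Function.Injective sHom := by
    rw [injective_iff_map_eq_zero]
    intro x hx
    have h1 : s x = 0 := hx
    have h2 := hsq x
    rw [h1, QuadraticMap.map_zero] at h2
    exact hq x (eq_zero_of_pow_eq_zero h2.symm)
  let sE : L ≃+ L := AddEquiv.ofBijective sHom (Finite.injective_iff_bijective.1 hsinj)
  have hsE : ∀ x, sE x = s x := fun x => rfl
  let ρ : F ≃+* F := RingEquiv.ofBijective (iterateFrobenius F 2 k)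
    (Finite.injective_iff_bijective.1 (RingHom.injective _))
  have hρ : ∀ a, ρ a = a ^ 2 ^ k := fun a => rfl
  let t : L ≃+ L :=
    { toFun := fun x => ⟨T x, (hTL x).2 x.2⟩
      invFun := fun x => ⟨T.symm x, (hTL _).1 (by rw [T.apply_symm_apply]; exact x.2)⟩
      left_inv := fun x => Subtype.ext (T.symm_apply_apply _)
      right_inv := fun x => Subtype.ext (T.apply_symm_apply _)
      map_add' := fun x y => Subtype.ext (map_add T _ _) }
  have ht : ∀ x : L, (t x : V) = T x := fun x => rfl
  rw [or_iff_not_imp_right]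
  intro hdisj
  rw [Submodule.disjoint_def] at hdisj
  push Not at hdisj
  obtain ⟨z, hzg, hzM, hz0⟩ := hdisj
  have hgraph : ∀ m ∈ M, ∃ x : L, m = x + τ (s x) := by
    intro m hm
    obtain ⟨x, hx, y, hxy⟩ := hdecomp L hL.1.1 hLL m
    refine ⟨⟨x, hx⟩, ?_⟩
    rw [← huniq ⟨x, hx⟩ y (by rw [← hxy]; exact hm)]
    exact hxy
  have hTgraph : ∀ x : L, T ((x : V) + τ (s x)) = (t x : V) + τ (t (s x)) := by
    intro x
    rw [map_add T, ← hTτ, ht, ht]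
  obtain ⟨m, rfl⟩ := T.surjective z
  have hm : m ∈ M := (hT M m).1 hzg
  obtain ⟨x₀, rfl⟩ := hgraph m hm
  have hx₀ : x₀ ≠ 0 := by
    rintro rfl
    refine hz0 ?_
    have h0 : s 0 = 0 := map_zero sHom
    simp [h0]
  rw [hTgraph] at hzM
  -- The common point of `g • M` and `M` says, by uniqueness of the graph, that `t (s x₀) = s (t
  -- x₀)`.
  have hcomm := semisimilitude_comm (s := sE) (t := t) (ρ := ρ) (σ := σ) (a := 1) (b := c)
    hq hL.1.1 (fun a x => hssmul a x) (fun a x => Subtype.ext (hTs a x))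
    (fun x => by rw [one_mul, hρ, hsE, hsq]) (fun x => hc x) hx₀ (huniq _ _ hzM)
  refine Submodule.eq_of_le_of_finrank_eq (fun y hy => ?_) (hgM.1.trans hM.1.symm)
  obtain ⟨y, rfl⟩ := T.surjective y
  obtain ⟨x, rfl⟩ := hgraph y ((hT M y).1 hy)
  have h1 : t (s x) = s (t x) := hcomm x
  rw [hTgraph, h1]
  exact hs _

/-- The regulus of `M` goes to that of `g • M`, and equal or skew lines determine the same regulus.
-/
theorem mem_regulusStabilizer_of_smul_eq (hF : Nat.card F = (2 ^ k) ^ 2)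
    (hW : IsSymplecticSubgeometry h W) (hQ : IsHyperbolic Q) (hQ₀ : IsElliptic Q₀)
    (hO : quadricPoints Q ∩ hermitianPoints h = subgeometryQuadricPoints W Q₀)
    (hτ : IsBaerInvolution h W Q τ) {g : Submodule F V ≃o Submodule F V}
    (hg : g ∈ quadricStabilizer h Q) {L : Submodule F V} (hL : L ∈ externalLines h W)
    (hgL : g • L = L) : g ∈ regulusStabilizer h Q := by
  have : Finite F := Nat.finite_of_card_ne_zero (by rw [hF]; positivity)
  refine mem_regulusStabilizer.2 ⟨hg, ?_⟩
  rintro _ ⟨M, hM, rfl⟩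
  rw [smul_regulusOf hQ hg]
  exact hQ.regulusOf_eq hM (smul_mem_quadricLines hQ hg hM)
    (smul_eq_or_disjoint hF hW hQ hQ₀ hO hτ hg hL hgL hM)

end Stabilizer

/-! ### Semiregularity on the orbits of a normal subgroup -/

section Orbits

variable {A X : Type*} [Group A] [MulAction A X]

theorem smul_orbit_of_normalizes {N : Subgroup A} {g : A} (h₁ : ∀ n ∈ N, g * n * g⁻¹ ∈ N)
    (h₂ : ∀ n ∈ N, g⁻¹ * n * g ∈ N) (x : X) :
    g • MulAction.orbit N x = MulAction.orbit N (g • x) := by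
  ext y
  rw [Set.mem_smul_set_iff_inv_smul_mem, MulAction.mem_orbit_iff, MulAction.mem_orbit_iff]
  constructor
  · rintro ⟨n, hn⟩
    refine ⟨⟨_, h₁ n n.2⟩, ?_⟩
    rw [Subgroup.mk_smul, smul_smul, inv_mul_cancel_right, mul_smul, ← Subgroup.smul_def, hn,
      smul_inv_smul]
  · rintro ⟨n, rfl⟩
    refine ⟨⟨_, h₂ n n.2⟩, ?_⟩
    rw [Subgroup.mk_smul, mul_smul, mul_smul, Subgroup.smul_def]

/-- If a normal subgroup contains the stabilisers in `G` of all points, then `G` acts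
semiregularly on its orbits. -/
theorem actsSemiregularlyOn_orbitsOn {G D : Subgroup A} {Ω : Set X}
    (hΩ : ∀ g ∈ G, ∀ ω ∈ Ω, g • ω ∈ Ω) (hD : ∀ g ∈ G, ∀ n ∈ D, g * n * g⁻¹ ∈ D)
    (hstab : ∀ g ∈ G, ∀ ω ∈ Ω, g • ω = ω → g ∈ D) :
    ActsSemiregularlyOn G (orbitsOn (G ⊓ D) Ω) := by
  have hsmul : ∀ g ∈ G, ∀ x : X, g • MulAction.orbit (G ⊓ D : Subgroup A) x =
      MulAction.orbit (G ⊓ D : Subgroup A) (g • x) := by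
    intro g hg x
    refine smul_orbit_of_normalizes
      (fun n hn => Subgroup.mem_inf.2 ⟨?_, hD g hg n hn.2⟩)
      (fun n hn => Subgroup.mem_inf.2 ⟨?_, ?_⟩) x
    · exact mul_mem (mul_mem hg hn.1) (inv_mem hg)
    · exact mul_mem (mul_mem (inv_mem hg) hn.1) hg
    · simpa using hD g⁻¹ (inv_mem hg) n hn.2
  constructor
  · rintro g hg _ ⟨ω, hω, rfl⟩
    exact ⟨g • ω, hΩ g hg ω hω, hsmul g hg ω⟩
  · rintro g hg _ ⟨ω, hω, rfl⟩ hfix _ ⟨ω', -, rfl⟩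
    rw [hsmul g hg] at hfix ⊢
    obtain ⟨n, hn⟩ := MulAction.orbit_eq_iff.1 hfix
    have hn' : (n : A) • ω = g • ω := hn
    -- An element fixing the orbit of `ω` differs from some `n` in `G ⊓ D` by an element fixing `ω`
    -- itself.
    have h1 := hstab ((n : A)⁻¹ * g) (mul_mem (inv_mem n.2.1) hg) ω hω (by
      rw [mul_smul, ← hn', inv_smul_smul])
    have hgD : g ∈ D := by simpa using mul_mem n.2.2 h1
    exact MulAction.orbit_eq_iff.2 ⟨⟨g, hg, hgD⟩, rfl⟩

end Orbits

end HermitianQuadric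

theorem proposition4p1 {F V : Type*} [Field F] [CharP F 2] [AddCommGroup V] [Module F V]
    (k : ℕ) (hk : 0 < k) (hF : Nat.card F = (2 ^ k) ^ 2) (hV : Module.finrank F V = 4)
    (h : V →ₗ[F] V →ₛₗ[iterateFrobenius F 2 k] F) (hh : HermitianQuadric.IsHermitianForm h)
    (W : Submodule (HermitianQuadric.subfieldGF F k) V)
    (hW : HermitianQuadric.IsSymplecticSubgeometry h W)
    (Q : QuadraticForm F V) (hQ : HermitianQuadric.IsHyperbolic Q)
    (hQH : ∃ Q₀ : QuadraticForm (HermitianQuadric.subfieldGF F k) W,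
      HermitianQuadric.IsElliptic Q₀ ∧
      HermitianQuadric.quadricPoints Q ∩ HermitianQuadric.hermitianPoints h =
        HermitianQuadric.subgeometryQuadricPoints W Q₀)
    (G : Subgroup (Submodule F V ≃o Submodule F V))
    (hG : G ≤ HermitianQuadric.quadricStabilizer h Q)
    (hGD : ¬ G ≤ HermitianQuadric.regulusStabilizer h Q) :
    HermitianQuadric.ActsSemiregularlyOn G
      (HermitianQuadric.orbitsOn (G ⊓ HermitianQuadric.regulusStabilizer h Q)
        (HermitianQuadric.externalLines h W)) := by
  have : Finite F := Nat.finite_of_card_ne_zero (by rw [hF]; positivity)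
  obtain ⟨Q₀, hQ₀, hO⟩ := hQH
  obtain ⟨c, τ, hc, hτ⟩ :=
    HermitianQuadric.exists_isBaerInvolution hk hF hh hW hQ hQ₀ hO
  -- Rescaling changes neither the points nor the reguli of the quadric, so `c • Q` may replace `Q`
  -- throughout.
  have hQ' := hQ.smul hc
  have hS : HermitianQuadric.quadricStabilizer h (c • Q) =
      HermitianQuadric.quadricStabilizer h Q := by
    rw [HermitianQuadric.quadricStabilizer, HermitianQuadric.quadricStabilizer,
      HermitianQuadric.quadricPoints_smul Q hc]
  have hR : HermitianQuadric.regulusStabilizer h (c • Q) =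
      HermitianQuadric.regulusStabilizer h Q := by
    rw [HermitianQuadric.regulusStabilizer, HermitianQuadric.regulusStabilizer, hS,
      HermitianQuadric.reguli_smul Q hc]
  rw [← HermitianQuadric.quadricPoints_smul Q hc] at hO
  rw [← hS] at hG
  rw [← hR]
  exact HermitianQuadric.actsSemiregularlyOn_orbitsOn
    (fun g hg L hL => HermitianQuadric.smul_mem_externalLines hF hW hQ' hQ₀ hO hτ (hG hg) hL)
    (fun g hg n hn => HermitianQuadric.conj_mem_regulusStabilizer hQ' (hG hg) hn)
    (fun g hg L hL hgL =>
      HermitianQuadric.mem_regulusStabilizer_of_smul_eq hF hW hQ' hQ₀ hO hτ (hG hg) hL hgL)
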